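/- **Setting.** Let $d,n\in\mathbb N$, let $U$ be a nonempty Polish space and $\lambda\in\mathbb R$. Let $\mathcal C_0$ (resp. $\mathcal D_0$) be the space of continuous (resp. càdlàg) functions $x:(-\infty,0]\to\mathbb R^d$ with $\lim_{\theta\to-\infty}x(\theta)=0$, with the norm $|x|_C=\sup_{\theta\le 0}|x(\theta)|$. For $h\ge 0$ let $x_h(\theta)=x(0)$ for $-h\le\theta\le 0$ and $x_h(\theta)=x(\theta+h)$ for $\theta<-h$. For $t\ge 0$ equip $\hat\Lambda^t=[t,\infty)\times\mathcal D_0$ with the metric $d_\infty((s,x),(l,y))=|l-s|+|x_{(l-s)\vee 0}-y_{(s-l)\vee 0}|_C$. For $f:\hat\Lambda^t\to\mathbb R$ set $$\partial_tf(s,x)=\lim_{h\downarrow 0}\frac{f(s+h,x_h)-f(s,x)}h,\qquad \partial_{x_i}f(s,x)=\lim_{h\to 0}\frac{f(s,x+he_i\mathbf 1_{\{0\}})-f(s,x)}h,$$ $\partial_xf=(\partial_{x_i}f)_i$ and $\partial_{xx}f=(\partial_{x_i}(\partial_{x_j}f))_{i,j}$. We write $f\in C^{1,2}_p(\hat\Lambda^t)$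 if these derivatives exist on all of $\hat\Lambda^t$, and $f,\partial_tf,\partial_xf,\partial_{xx}f$ are continuous for $d_\infty$ and of polynomial growth, i.e. bounded by $C(1+s+|x|_C)^k$ for some $C\ge 0$ and $k\in\mathbb N$. Functions $b:\mathcal C_0\times U\to\mathbb R^d$, $\sigma:\mathcal C_0\times U\to\mathbb R^{d\times n}$, $q:\mathcal C_0\times U\to\mathbb R$ are called *admissible* if they are continuous and there is $L>0$ such that for all $x,y\in\mathcal C_0$, $u\in U$ $$|b(x,u)|^2\vee|\sigma(x,u)|_2^2\vee|q(x,u)|^2\le L^2(1+|x|_C^2),$$ $$|b(x,u)-b(y,u)|\vee|\sigma(x,u)-\sigma(y,u)|_2\vee|q(x,u)-q(y,u)|\le L|x-y|_C,$$ where $|\cdot|_2$ is the Hilbert–Schmidt norm. For admissible $(b,\sigma,q)$ consider the equation $$-\lambda V(x)+\partial_tV(x)+\mathbf H(x,\partial_xV(x),\partial_{xx}V(x))=0,\quad x\in\mathcal C_0,\tag{1.4}$$ $$\mathbf H(x,p,l)=\inf_{u\in U}\Big[(p,b(x,u))_{\mathbb R^d}+\tfrac12\operatorname{tr}\big(l\,\sigma(x,u)\sigma(x,u)^\top\big)+q(x,u)\Big].$$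 A continuous $w:\mathcal C_0\to\mathbb R$ is a *viscosity subsolution* of (1.4) if for all $t\ge 0$, $x\in\mathcal C_0$ and $\varphi\in C^{1,2}_p(\hat\Lambda^t)$ with $0=w(x)-\varphi(t,x)=\sup_{s\ge t,\,y\in\mathcal C_0}(w(y)-\varphi(s,y))$, $$-\lambda w(x)+\partial_t\varphi(t,x)+\mathbf H(x,\partial_x\varphi(t,x),\partial_{xx}\varphi(t,x))\ge 0.$$ It is a *viscosity supersolution* of (1.4) if for all $t\ge 0$, $x\in\mathcal C_0$ and $\varphi\in C^{1,2}_p(\hat\Lambda^t)$ with $0=w(x)+\varphi(t,x)=\inf_{s\ge t,\,y\in\mathcal C_0}(w(y)+\varphi(s,y))$, $$-\lambda w(x)-\partial_t\varphi(t,x)+\mathbf H(x,-\partial_x\varphi(t,x),-\partial_{xx}\varphi(t,x))\le 0.$$ **Theorem 5.7.** Let $(b,\sigma,q)$ be admissible and let $v:\mathcal C_0\to\mathbb R$ be continuous. Assume that (i) for every $\varepsilon>0$ there are an admissible triple $(b^\varepsilon,\sigma^\varepsilon,q^\varepsilon)$ (with a constant $L$ that may depend on $\varepsilon$) and a continuous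 $v^\varepsilon:\mathcal C_0\to\mathbb R$ that is a viscosity subsolution (resp., supersolution) of (1.4) with $b,\sigma,q$ replaced by $b^\varepsilon,\sigma^\varepsilon,q^\varepsilon$; (ii) $$\lim_{\varepsilon\downarrow 0}\ \sup_{(x,u)\in\mathcal C_0\times U}\Big[\big(|b^\varepsilon-b|+|\sigma^\varepsilon-\sigma|_2+|q^\varepsilon-q|\big)(x,u)+|v^\varepsilon-v|(x)\Big]=0.$$ Then $v$ is a viscosity subsolution (resp., supersolution) of (1.4) with the coefficients $b,\sigma,q$. -/

import Mathlib

open Filter Topology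

noncomputable section

namespace DelayHJB

/-- The half line `(-∞, 0]`. -/
abbrev Past : Type := Set.Iic (0 : ℝ)

/-- The time `0`, as a point of `(-∞, 0]`. -/
def now : Past := ⟨0, Set.mem_Iic.mpr le_rfl⟩

/-- `ℝ^d` with its Euclidean norm. -/
abbrev E (d : ℕ) : Type := EuclideanSpace ℝ (Fin d)

/-- The Banach space `𝒞₀` of continuous paths `(-∞, 0] → ℝ^d` vanishing at `-∞`, with the
supremum norm (vanishing at infinity on `(-∞, 0]` is vanishing at `-∞`). -/
abbrev C0 (d : ℕ) : Type := ZeroAtInftyContinuousMap Past (E d)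

/-- Right continuous with left limits at every point of `(-∞, 0]`. -/
def IsCadlag {d : ℕ} (x : Past → E d) : Prop :=
  ∀ θ : Past, ContinuousWithinAt x (Set.Ici θ) θ ∧ ∃ l : E d, Tendsto x (𝓝[<] θ) (𝓝 l)

/-- The space `𝒟₀` of càdlàg paths `(-∞, 0] → ℝ^d` vanishing at `-∞`, with pointwise
operations. Its norm is `supNorm` below. -/
def D0 (d : ℕ) : Submodule ℝ (Past → E d) where
  carrier := {x | IsCadlag x ∧ Tendsto x atBot (𝓝 0)}
  add_mem' := by
    rintro x y ⟨hx, hx0⟩ ⟨hy, hy0⟩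
    refine ⟨fun θ => ⟨(hx θ).1.add (hy θ).1, ?_⟩, by
      have h := hx0.add hy0
      rwa [add_zero] at h⟩
    obtain ⟨l, hl⟩ := (hx θ).2
    obtain ⟨m, hm⟩ := (hy θ).2
    exact ⟨l + m, hl.add hm⟩
  zero_mem' := ⟨fun _ => ⟨continuousWithinAt_const, 0, tendsto_const_nhds⟩, tendsto_const_nhds⟩
  smul_mem' := by
    rintro c x ⟨hx, hx0⟩
    refine ⟨fun θ => ⟨(hx θ).1.const_smul c, ?_⟩, by
      have h := hx0.const_smul c
      rwa [smul_zero] at h⟩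
    obtain ⟨l, hl⟩ := (hx θ).2
    exact ⟨c • l, hl.const_smul c⟩

variable {d n : ℕ}

/-- The inclusion of `𝒞₀` in `𝒟₀`. -/
def C0.toD0 (x : C0 d) : D0 d :=
  ⟨fun θ => x θ,
    fun θ => ⟨x.continuous.continuousWithinAt, x θ, x.continuous.continuousWithinAt⟩,
    x.zero_at_infty'.mono_left atBot_le_cocompact⟩

/-- The norm `|x|_C = sup_{θ ≤ 0} |x(θ)|` on `𝒟₀`. -/
def supNorm (x : D0 d) : ℝ := ⨆ θ : Past, ‖(x : Past → E d) θ‖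

/-- A path of `𝒟₀` is bounded, so that `supNorm` is a genuine supremum. -/
theorem D0.bddAbove (x : D0 d) :
    BddAbove (Set.range fun θ : Past => ‖(x : Past → E d) θ‖) := by
  obtain ⟨x, hx, hx0⟩ := x
  change BddAbove (Set.range fun θ : Past => ‖x θ‖)
  have hloc : ∀ θ : Past, ∃ s ∈ 𝓝 θ, BddAbove ((fun θ => ‖x θ‖) '' s) := by
    intro θ
    obtain ⟨l, hl⟩ := (hx θ).2
    have h1 : ∀ᶠ η in 𝓝[<] θ, ‖x η‖ < ‖l‖ + 1 := hl.norm.eventually_lt_const (by linarith)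
    have h2 : ∀ᶠ η in 𝓝[≥] θ, ‖x η‖ < ‖x θ‖ + 1 :=
      (hx θ).1.norm.eventually_lt_const (by linarith)
    have h3 : ∀ᶠ η in 𝓝 θ, ‖x η‖ ≤ max (‖l‖ + 1) (‖x θ‖ + 1) := by
      rw [← nhdsLT_sup_nhdsGE]
      exact eventually_sup.mpr ⟨h1.mono fun _ h => h.le.trans (le_max_left _ _),
        h2.mono fun _ h => h.le.trans (le_max_right _ _)⟩
    exact ⟨_, h3, _, by rintro _ ⟨η, h, rfl⟩; exact h⟩
  have h0 : ∀ᶠ η in atBot, ‖x η‖ < 1 := by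
    have h := hx0.norm
    rw [norm_zero] at h
    exact h.eventually_lt_const one_pos
  obtain ⟨a, ha⟩ := eventually_atBot.mp h0
  have hcomp : IsCompact (Set.Icc a now) := by
    rw [Subtype.isCompact_iff]
    refine (isCompact_Icc (a := (a : ℝ)) (b := 0)).of_isClosed_subset ?_ ?_
    · exact (isClosed_Iic.isClosedEmbedding_subtypeVal.isClosedMap _ isClosed_Icc)
    · rintro _ ⟨η, hη, rfl⟩
      exact ⟨hη.1, η.2⟩
  have hK : BddAbove ((fun θ => ‖x θ‖) '' Set.Icc a now) := by
    refine hcomp.induction_on (p := fun s => BddAbove ((fun θ => ‖x θ‖) '' s))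
      (by simp) (fun s t hst ht => ht.mono (Set.image_mono hst))
      (fun s t hs ht => by rw [Set.image_union]; exact hs.union ht) ?_
    intro θ _
    obtain ⟨s, hs, hb⟩ := hloc θ
    exact ⟨s, mem_nhdsWithin_of_mem_nhds hs, hb⟩
  obtain ⟨M, hM⟩ := hK
  refine ⟨max M 1, ?_⟩
  rintro _ ⟨η, rfl⟩
  rcases le_total η a with h | h
  · exact (ha η h).le.trans (le_max_right _ _)
  · exact (hM ⟨η, ⟨h, η.2⟩, rfl⟩).trans (le_max_left _ _)

/-- `θ ↦ min (θ + h) 0`, as a self-map of `(-∞, 0]`. -/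
def shiftTime (h : ℝ) (θ : Past) : Past := ⟨min ((θ : ℝ) + h) 0, Set.mem_Iic.mpr (min_le_right _ _)⟩

/-- The path `x_h`, that is `x_h(θ) = x(0)` for `-h ≤ θ ≤ 0` and `x_h(θ) = x(θ + h)` for
`θ < -h`. It is only used with `h ≥ 0`. -/
def freeze (x : D0 d) (h : ℝ) : D0 d :=
  ⟨fun θ => (x : Past → E d) (shiftTime h θ), by
    obtain ⟨x, hx, hx0⟩ := x
    have hc : Continuous (shiftTime h) := by unfold shiftTime; fun_prop
    have hm : Monotone (shiftTime h) := fun a b hab =>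
      Subtype.mk_le_mk.mpr (min_le_min_right _ (add_le_add_left
        (show (a : ℝ) ≤ b from hab) h))
    refine ⟨fun θ => ⟨?_, ?_⟩, ?_⟩
    · exact (hx (shiftTime h θ)).1.comp hc.continuousWithinAt fun η hη => hm hη
    · rcases le_or_gt ((θ : ℝ) + h) 0 with hθ | hθ
      · obtain ⟨l, hl⟩ := (hx (shiftTime h θ)).2
        refine ⟨l, hl.comp (tendsto_nhdsWithin_iff.mpr
          ⟨hc.continuousAt.tendsto.mono_left nhdsWithin_le_nhds, ?_⟩)⟩
        filter_upwards [self_mem_nhdsWithin] with η hη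
        have hlt : (η : ℝ) < θ := hη
        change min ((η : ℝ) + h) 0 < min ((θ : ℝ) + h) 0
        rw [min_eq_left hθ]
        exact (min_le_left _ _).trans_lt (by linarith)
      · refine ⟨x now, tendsto_const_nhds.congr' ?_⟩
        have hopen : ∀ᶠ η : Past in 𝓝 θ, 0 < (η : ℝ) + h :=
          (continuous_subtype_val.add continuous_const).continuousAt.eventually_const_lt hθ
        filter_upwards [mem_nhdsWithin_of_mem_nhds hopen] with η hη
        exact congrArg x (Subtype.ext (min_eq_right (le_of_lt hη)).symm)
    · refine hx0.comp (tendsto_atBot.mpr fun a => ?_)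
      have hmem : min ((a : ℝ) - h) 0 ∈ Set.Iic (0 : ℝ) := Set.mem_Iic.mpr (min_le_right _ _)
      filter_upwards [eventually_le_atBot (⟨_, hmem⟩ : Past)] with η hη
      have h1 : (η : ℝ) ≤ min ((a : ℝ) - h) 0 := hη
      have h2 := h1.trans (min_le_left _ _)
      exact Subtype.mk_le_mk.mpr ((min_le_left _ _).trans (by linarith))⟩

/-- The path `e_i 1_{\{0\}}`: the `i`-th unit vector at time `0`, and `0` before. -/
def bump (i : Fin d) : D0 d :=
  ⟨fun θ => if θ = now then EuclideanSpace.single i (1 : ℝ) else 0, by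
    have hneg : ∀ η θ : Past, η < θ → η ≠ now := by
      rintro η θ h rfl
      exact absurd (show (θ : ℝ) ≤ 0 from θ.2) (not_le.mpr h)
    refine ⟨fun θ => ⟨?_, 0, ?_⟩, ?_⟩
    · by_cases hθ : θ = now
      · subst hθ
        have hs : Set.Ici now = {now} := by
          ext η
          exact ⟨fun h => le_antisymm (show (η : ℝ) ≤ 0 from η.2) h, fun h => Set.mem_Ici.mpr (h ▸ le_rfl)⟩
        rw [hs]
        exact continuousWithinAt_singleton
      · refine ContinuousAt.continuousWithinAt ?_
        refine (continuousAt_const (y := (0 : E d))).congr ?_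
        filter_upwards [isOpen_ne.mem_nhds hθ] with η hη
        rw [if_neg hη]
    · refine tendsto_const_nhds.congr' ?_
      filter_upwards [self_mem_nhdsWithin] with η hη
      rw [if_neg (hneg η θ hη)]
    · refine tendsto_const_nhds.congr' ?_
      filter_upwards [eventually_lt_atBot now] with η hη
      rw [if_neg (hneg η now hη)]⟩

/-- The distance `d_∞((s, x), (l, y))`, equal to `|l - s| + |x_{l-s} - y|_C` if `s ≤ l` and
symmetric. -/
def dInfty (s : ℝ) (x : D0 d) (l : ℝ) (y : D0 d) : ℝ :=
  |l - s| + supNorm (freeze x (max (l - s) 0) - freeze y (max (s - l) 0))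

/-! Functionals on `[t, ∞) × 𝒟₀` are written as total functions of `(s, x)`; every condition
below only involves their values at times `s ≥ t`. -/

/-- Continuity on `([t, ∞) × 𝒟₀, d_∞)`. -/
def ContOn (t : ℝ) (f : ℝ → D0 d → ℝ) : Prop :=
  ∀ s, t ≤ s → ∀ x : D0 d, ∀ ε > 0, ∃ δ > 0, ∀ l, t ≤ l → ∀ y : D0 d,
    dInfty s x l y < δ → |f l y - f s x| < ε

/-- Polynomial growth on `[t, ∞) × 𝒟₀`. -/
def PolyGrowth (t : ℝ) (f : ℝ → D0 d → ℝ) : Prop :=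
  ∃ (C : ℝ) (k : ℕ), ∀ s, t ≤ s → ∀ x : D0 d, |f s x| ≤ C * (1 + |s| + supNorm x) ^ k

/-- The horizontal derivative `∂_t f(s, x)`, a right derivative. -/
def horizDeriv (f : ℝ → D0 d → ℝ) (s : ℝ) (x : D0 d) : ℝ :=
  derivWithin (fun h : ℝ => f (s + h) (freeze x h)) (Set.Ici 0) 0

/-- The vertical derivative `∂_{x_i} f(s, x)`. -/
def vertDeriv (i : Fin d) (f : ℝ → D0 d → ℝ) (s : ℝ) (x : D0 d) : ℝ :=
  deriv (fun h : ℝ => f s (x + h • bump i)) 0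

/-- The vertical gradient `∂_x f(s, x)`. -/
def vertGrad (f : ℝ → D0 d → ℝ) (s : ℝ) (x : D0 d) : E d :=
  WithLp.toLp 2 fun i => vertDeriv i f s x

/-- The matrix `∂_{xx} f(s, x)` with entries `∂_{x_i} (∂_{x_j} f) (s, x)`. -/
def vertHess (f : ℝ → D0 d → ℝ) (s : ℝ) (x : D0 d) : Matrix (Fin d) (Fin d) ℝ :=
  Matrix.of fun i j => vertDeriv i (vertDeriv j f) s x

/-- The class `C_p^{1,2}([t, ∞) × 𝒟₀)`: the functional and its pathwise derivatives
`∂_t, ∂_x, ∂_{xx}` exist, are continuous for `d_∞` and have polynomial growth. -/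
structure IsC12p (t : ℝ) (f : ℝ → D0 d → ℝ) : Prop where
  horiz_exists : ∀ s, t ≤ s → ∀ x : D0 d,
    DifferentiableWithinAt ℝ (fun h : ℝ => f (s + h) (freeze x h)) (Set.Ici 0) 0
  vert_exists : ∀ i : Fin d, ∀ s, t ≤ s → ∀ x : D0 d,
    DifferentiableAt ℝ (fun h : ℝ => f s (x + h • bump i)) 0
  vert2_exists : ∀ i j : Fin d, ∀ s, t ≤ s → ∀ x : D0 d,
    DifferentiableAt ℝ (fun h : ℝ => vertDeriv j f s (x + h • bump i)) 0
  cont : ContOn t f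
  cont_horiz : ContOn t (horizDeriv f)
  cont_vert : ∀ i, ContOn t (vertDeriv i f)
  cont_vert2 : ∀ i j, ContOn t (vertDeriv i (vertDeriv j f))
  growth : PolyGrowth t f
  growth_horiz : PolyGrowth t (horizDeriv f)
  growth_vert : ∀ i, PolyGrowth t (vertDeriv i f)
  growth_vert2 : ∀ i j, PolyGrowth t (vertDeriv i (vertDeriv j f))

section HilbertSchmidt

attribute [local instance] Matrix.frobeniusNormedAddCommGroup

/-- The Hilbert-Schmidt norm `|A|₂` of a matrix. -/
def hsNorm (A : Matrix (Fin d) (Fin n) ℝ) : ℝ := ‖A‖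

end HilbertSchmidt

/-- The generators `b, σ, q` of the equation, as bare functions on `𝒞₀ × U`. -/
structure Generators (d n : ℕ) (U : Type*) where
  b : C0 d × U → E d
  σ : C0 d × U → Matrix (Fin d) (Fin n) ℝ
  q : C0 d × U → ℝ

/-- The standing hypothesis on the generators: continuity, and linear growth and Lipschitz
continuity in the path, uniformly in the control. -/
def Generators.Standing {U : Type*} [TopologicalSpace U] (G : Generators d n U) : Prop :=
  Continuous G.b ∧ Continuous G.σ ∧ Continuous G.q ∧
  ∃ L : ℝ, 0 < L ∧
    (∀ (x : C0 d) (u : U),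
      ‖G.b (x, u)‖ ^ 2 ≤ L ^ 2 * (1 + ‖x‖ ^ 2) ∧
      hsNorm (G.σ (x, u)) ^ 2 ≤ L ^ 2 * (1 + ‖x‖ ^ 2) ∧
      |G.q (x, u)| ^ 2 ≤ L ^ 2 * (1 + ‖x‖ ^ 2)) ∧
    (∀ (x y : C0 d) (u : U),
      ‖G.b (x, u) - G.b (y, u)‖ ≤ L * ‖x - y‖ ∧
      hsNorm (G.σ (x, u) - G.σ (y, u)) ≤ L * ‖x - y‖ ∧
      |G.q (x, u) - G.q (y, u)| ≤ L * ‖x - y‖)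

/-- The Hamiltonian `H(x, p, l) = inf_u [(p, b(x,u)) + ½ tr(l σ(x,u) σ(x,u)ᵀ) + q(x,u)]`.
The infimum is finite under the standing hypothesis with `U` nonempty. -/
def Generators.hamiltonian {U : Type*} (G : Generators d n U)
    (x : C0 d) (p : E d) (l : Matrix (Fin d) (Fin d) ℝ) : ℝ :=
  ⨅ u : U, (inner ℝ p (G.b (x, u))
    + (1 / 2 : ℝ) * (l * (G.σ (x, u) * (G.σ (x, u)).transpose)).trace + G.q (x, u))

/-- The test functionals `𝒜⁺(t, x, w)`: those of class `C_p^{1,2}` with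
`0 = w(x) - φ(t, x) = sup (w(y) - φ(s, y))`, the supremum over `(s, y) ∈ [t, ∞) × 𝒞₀`.
A test functional is given through its extension to `[t, ∞) × 𝒟₀`. -/
def testAbove (t : ℝ) (x : C0 d) (w : C0 d → ℝ) : Set (ℝ → D0 d → ℝ) :=
  {φ | IsC12p t φ ∧ w x - φ t x.toD0 = 0 ∧
    IsLUB {r : ℝ | ∃ s, t ≤ s ∧ ∃ y : C0 d, r = w y - φ s y.toD0} 0}

/-- The test functionals `𝒜⁻(t, x, w)`: those of class `C_p^{1,2}` with
`0 = w(x) + φ(t, x) = inf (w(y) + φ(s, y))`, the infimum over `(s, y) ∈ [t, ∞) × 𝒞₀`. -/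
def testBelow (t : ℝ) (x : C0 d) (w : C0 d → ℝ) : Set (ℝ → D0 d → ℝ) :=
  {φ | IsC12p t φ ∧ w x + φ t x.toD0 = 0 ∧
    IsGLB {r : ℝ | ∃ s, t ≤ s ∧ ∃ y : C0 d, r = w y + φ s y.toD0} 0}

/-- Viscosity subsolutions of `-λ V + ∂_t V + H(x, ∂_x V, ∂_{xx} V) = 0`. -/
def IsViscositySubsolution {U : Type*} (lam : ℝ) (G : Generators d n U) (w : C0 d → ℝ) : Prop :=
  Continuous w ∧ ∀ s : ℝ, 0 ≤ s → ∀ x : C0 d, ∀ φ ∈ testAbove s x w,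
    0 ≤ -lam * w x + horizDeriv φ s x.toD0
      + G.hamiltonian x (vertGrad φ s x.toD0) (vertHess φ s x.toD0)

/-- Viscosity supersolutions of `-λ V + ∂_t V + H(x, ∂_x V, ∂_{xx} V) = 0`. -/
def IsViscositySupersolution {U : Type*} (lam : ℝ) (G : Generators d n U) (w : C0 d → ℝ) :
    Prop :=
  Continuous w ∧ ∀ s : ℝ, 0 ≤ s → ∀ x : C0 d, ∀ φ ∈ testBelow s x w,
    -lam * w x - horizDeriv φ s x.toD0
      + G.hamiltonian x (-vertGrad φ s x.toD0) (-vertHess φ s x.toD0) ≤ 0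

/-- The supremum over `(x, u) ∈ 𝒞₀ × U` of
`(|b' - b| + |σ' - σ|₂ + |q' - q|)(x, u) + |v' - v|(x)`, with values in `[0, ∞]`. -/
def unifDist {U : Type*} (G' G : Generators d n U) (v' v : C0 d → ℝ) : ENNReal :=
  ⨆ p : C0 d × U, ENNReal.ofReal
    (‖G'.b p - G.b p‖ + hsNorm (G'.σ p - G.σ p) + |G'.q p - G.q p| + |v' p.1 - v p.1|)

end DelayHJB

end

noncomputable section

namespace DelayHJB

variable {d n : ℕ}

/-! ### Paths, their norms and freezing -/

/-! The proof is the stability argument for viscosity solutions. If `φ` touches `v` from above at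
`(t, x)` and `vε` is uniformly close to `v`, then `(t, x)` almost maximizes `vε - φ`. A slightly
perturbed `φ` should then touch `vε` from above at a nearby point, where the inequality for `vε` is
available, and the limit can be taken. Since `𝒞₀` is not locally compact and the maximum need not be
strict, the nearby maximum comes from a Borwein-Preiss variational principle
(`exists_penalized_maximum`).

The perturbation must itself be of class `C_p^{1,2}`, which the sup norm is not. The substitute is
`gauge`, i.e. `(|x|_C² - |x(0)|²)³ + |x(0)|⁶`. Freezing a path does not change it. Along a vertical
bump only `x(0)` moves, and the first term is then the cube of the positive part of a smooth
function, hence `C²`. It is comparable to `|x|_C⁶`, so it controls distances. The penalty at a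
centre `(l, a)` is `(s - l)² + gauge (x - a_{s-l})`, and a series of such penalties with weights
`2⁻ⁱ` and bounded centres is still `C_p^{1,2}` (`isC12p_penaltySum`).

Penalties make sense only after the time of their centre, so the principle is run along the preorder
of times: centres move forward, and the limit point `(s, y)` is a maximum among times `≥ s`. This is
exactly what a test functional at time `s` requires. If the uniform error is `r⁶/2` with `r ≤ 1`,
all penalties at `(s, y)` are at most `r⁶`, so the derivatives of the perturbation are `O(r)`
(`exists_testAbove_near`).

The Hamiltonians converge because their integrands converge uniformly in the control to a bounded
limit (`tendsto_hamiltonian`). Supersolutions reduce to the same test functionals by replacing `w`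
with `-w`. -/

theorem le_supNorm (x : D0 d) (θ : Past) : ‖(x : Past → E d) θ‖ ≤ supNorm x :=
  le_ciSup (D0.bddAbove x) θ

theorem supNorm_nonneg (x : D0 d) : 0 ≤ supNorm x :=
  (norm_nonneg _).trans (le_supNorm x now)

theorem supNorm_le {x : D0 d} {c : ℝ} (h : ∀ θ, ‖(x : Past → E d) θ‖ ≤ c) : supNorm x ≤ c :=
  haveI : Nonempty Past := ⟨now⟩
  ciSup_le h

theorem supNorm_add_le (x y : D0 d) : supNorm (x + y) ≤ supNorm x + supNorm y :=
  supNorm_le fun θ => (norm_add_le _ _).trans (add_le_add (le_supNorm x θ) (le_supNorm y θ))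

theorem supNorm_neg (x : D0 d) : supNorm (-x) = supNorm x := by
  unfold supNorm
  congr 1
  ext θ
  exact norm_neg _

theorem supNorm_sub_le (x y : D0 d) : supNorm (x - y) ≤ supNorm x + supNorm y := by
  rw [sub_eq_add_neg, ← supNorm_neg y]
  exact supNorm_add_le _ _

theorem abs_supNorm_sub_supNorm_le (x y : D0 d) : |supNorm x - supNorm y| ≤ supNorm (x - y) := by
  rw [abs_sub_le_iff]
  constructor
  · have h := supNorm_add_le (x - y) y
    rw [sub_add_cancel] at h
    linarith
  · have h := supNorm_add_le (y - x) x
    rw [sub_add_cancel, ← neg_sub x y, supNorm_neg] at h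
    linarith

@[simp] theorem freeze_apply (x : D0 d) (h : ℝ) (θ : Past) :
    (freeze x h : Past → E d) θ = (x : Past → E d) (shiftTime h θ) := rfl

theorem shiftTime_now {h : ℝ} (hh : 0 ≤ h) : shiftTime h now = now :=
  Subtype.ext (min_eq_right (by simpa [now] using hh))

theorem freeze_now (x : D0 d) {h : ℝ} (hh : 0 ≤ h) :
    (freeze x h : Past → E d) now = (x : Past → E d) now := by
  rw [freeze_apply, shiftTime_now hh]

theorem shiftTime_zero (θ : Past) : shiftTime 0 θ = θ :=
  Subtype.ext (by have hθ : (θ : ℝ) ≤ 0 := θ.2; simp [shiftTime, hθ])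

theorem freeze_zero (x : D0 d) : freeze x 0 = x := by
  ext1; funext θ
  rw [freeze_apply, shiftTime_zero]

theorem shiftTime_shiftTime {g h : ℝ} (hg : 0 ≤ g) (θ : Past) :
    shiftTime g (shiftTime h θ) = shiftTime (g + h) θ := by
  refine Subtype.ext ?_
  change min (min ((θ : ℝ) + h) 0 + g) 0 = min ((θ : ℝ) + (g + h)) 0
  rcases le_total ((θ : ℝ) + h) 0 with h1 | h1
  · rw [min_eq_left h1]; ring_nf
  · rw [min_eq_right h1, min_eq_right (by linarith), min_eq_right (by linarith)]

theorem freeze_freeze (x : D0 d) {g : ℝ} (h : ℝ) (hg : 0 ≤ g) :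
    freeze (freeze x g) h = freeze x (g + h) := by
  ext1; funext θ
  rw [freeze_apply, freeze_apply, freeze_apply, shiftTime_shiftTime hg]

theorem freeze_sub (x y : D0 d) (h : ℝ) : freeze (x - y) h = freeze x h - freeze y h := rfl

theorem shiftTime_surjective {h : ℝ} (hh : 0 ≤ h) : Function.Surjective (shiftTime h) := by
  intro θ
  have hθ : (θ : ℝ) ≤ 0 := θ.2
  exact ⟨⟨(θ : ℝ) - h, Set.mem_Iic.mpr (by linarith)⟩,
    Subtype.ext (by simp [shiftTime, hθ])⟩

theorem supNorm_freeze (x : D0 d) {h : ℝ} (hh : 0 ≤ h) : supNorm (freeze x h) = supNorm x :=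
  (shiftTime_surjective hh).iSup_comp fun θ => ‖(x : Past → E d) θ‖

theorem dInfty_of_le {s l : ℝ} (h : s ≤ l) (x y : D0 d) :
    dInfty s x l y = (l - s) + supNorm (freeze x (l - s) - y) := by
  unfold dInfty
  rw [abs_of_nonneg (by linarith), max_eq_left (by linarith), max_eq_right (by linarith),
    freeze_zero]

theorem dInfty_of_ge {s l : ℝ} (h : l ≤ s) (x y : D0 d) :
    dInfty s x l y = (s - l) + supNorm (x - freeze y (s - l)) := by
  unfold dInfty
  rw [abs_sub_comm, abs_of_nonneg (by linarith), max_eq_right (by linarith),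
    max_eq_left (by linarith), freeze_zero]

theorem abs_le_dInfty (s : ℝ) (x : D0 d) (l : ℝ) (y : D0 d) : |l - s| ≤ dInfty s x l y :=
  le_add_of_nonneg_right (supNorm_nonneg _)

theorem dInfty_nonneg (s : ℝ) (x : D0 d) (l : ℝ) (y : D0 d) : 0 ≤ dInfty s x l y :=
  (abs_nonneg _).trans (abs_le_dInfty s x l y)

theorem supNorm_le_add_dInfty (s : ℝ) (x : D0 d) (l : ℝ) (y : D0 d) :
    supNorm y ≤ supNorm x + dInfty s x l y := by
  have h1 := abs_supNorm_sub_supNorm_le (freeze x (max (l - s) 0)) (freeze y (max (s - l) 0))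
  rw [supNorm_freeze _ (le_max_right _ _), supNorm_freeze _ (le_max_right _ _)] at h1
  have h2 := (abs_le.mp h1).1
  have h3 := abs_nonneg (l - s)
  unfold dInfty
  linarith

theorem abs_apply_now_sub_le (s : ℝ) (x : D0 d) (l : ℝ) (y : D0 d) (i : Fin d) :
    |(y : Past → E d) now i - (x : Past → E d) now i| ≤ dInfty s x l y := by
  have h := le_supNorm (freeze x (max (l - s) 0) - freeze y (max (s - l) 0)) now
  have h' : ‖(x : Past → E d) now - (y : Past → E d) now‖ ≤
      supNorm (freeze x (max (l - s) 0) - freeze y (max (s - l) 0)) := by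
    rw [← freeze_now x (le_max_right (l - s) 0), ← freeze_now y (le_max_right (s - l) 0)]
    exact h
  rw [abs_sub_comm]
  have h1 := PiLp.norm_apply_le ((x : Past → E d) now - (y : Past → E d) now) i
  rw [PiLp.sub_apply, Real.norm_eq_abs] at h1
  unfold dInfty
  have h3 := abs_nonneg (l - s)
  linarith

/-! ### Continuity along `d_∞` as convergence along a filter -/

/-- The neighbourhoods of `(s, x)` in `[t, ∞) × 𝒟₀` for `d_∞`. -/
def pathNhds (t s : ℝ) (x : D0 d) : Filter (ℝ × D0 d) :=
  comap (fun p => dInfty s x p.1 p.2) (𝓝 0) ⊓ 𝓟 {p | t ≤ p.1}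

theorem pathNhds_hasBasis (t s : ℝ) (x : D0 d) :
    (pathNhds t s x).HasBasis (fun δ : ℝ => 0 < δ)
      fun δ => {p | t ≤ p.1 ∧ dInfty s x p.1 p.2 < δ} := by
  refine (((Metric.nhds_basis_ball (x := (0 : ℝ))).comap _).inf_principal _).congr
    (fun _ => Iff.rfl) fun δ _ => ?_
  ext p
  simp [abs_of_nonneg (dInfty_nonneg s x p.1 p.2), and_comm]

/-- Phrasing `d_∞`-continuity through a filter lets sums, products and dominated series inherit it
from the usual limit theorems. -/
theorem contOn_iff_tendsto {t : ℝ} {f : ℝ → D0 d → ℝ} :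
    ContOn t f ↔ ∀ s, t ≤ s → ∀ x : D0 d,
      Tendsto (fun p : ℝ × D0 d => f p.1 p.2) (pathNhds t s x) (𝓝 (f s x)) := by
  refine forall₃_congr fun s _ x => ?_
  rw [(pathNhds_hasBasis t s x).tendsto_iff Metric.nhds_basis_ball]
  exact forall₂_congr fun ε _ => exists_congr fun δ => and_congr_right fun _ =>
    ⟨fun H p hp => H p.1 hp.1 p.2 hp.2, fun H l hl y hd => H (l, y) ⟨hl, hd⟩⟩

theorem tendsto_pathNhds {ι : Type*} {F : Filter ι} {t s : ℝ} {x : D0 d} {l : ι → ℝ}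
    {y : ι → D0 d} (h : Tendsto (fun k => dInfty s x (l k) (y k)) F (𝓝 0))
    (hl : ∀ᶠ k in F, t ≤ l k) : Tendsto (fun k => (l k, y k)) F (pathNhds t s x) :=
  tendsto_inf.mpr ⟨tendsto_comap_iff.mpr h, tendsto_principal.mpr hl⟩

theorem ContOn.of_lipschitz {t : ℝ} {f : ℝ → D0 d → ℝ}
    (h : ∀ s, t ≤ s → ∀ x, ∀ l, t ≤ l → ∀ y, |f l y - f s x| ≤ dInfty s x l y) : ContOn t f :=
  fun s hs x ε hε => ⟨ε, hε, fun l hl y hd => (h s hs x l hl y).trans_lt hd⟩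

theorem ContOn.const (t c : ℝ) : ContOn t fun _ (_ : D0 d) => c :=
  contOn_iff_tendsto.mpr fun _ _ _ => tendsto_const_nhds

theorem ContOn.add {t : ℝ} {f g : ℝ → D0 d → ℝ} (hf : ContOn t f) (hg : ContOn t g) :
    ContOn t fun s x => f s x + g s x :=
  contOn_iff_tendsto.mpr fun s hs x =>
    (contOn_iff_tendsto.mp hf s hs x).add (contOn_iff_tendsto.mp hg s hs x)

theorem ContOn.sub {t : ℝ} {f g : ℝ → D0 d → ℝ} (hf : ContOn t f) (hg : ContOn t g) :
    ContOn t fun s x => f s x - g s x :=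
  contOn_iff_tendsto.mpr fun s hs x =>
    (contOn_iff_tendsto.mp hf s hs x).sub (contOn_iff_tendsto.mp hg s hs x)

theorem ContOn.mul {t : ℝ} {f g : ℝ → D0 d → ℝ} (hf : ContOn t f) (hg : ContOn t g) :
    ContOn t fun s x => f s x * g s x :=
  contOn_iff_tendsto.mpr fun s hs x =>
    (contOn_iff_tendsto.mp hf s hs x).mul (contOn_iff_tendsto.mp hg s hs x)

theorem ContOn.pow {t : ℝ} {f : ℝ → D0 d → ℝ} (hf : ContOn t f) (k : ℕ) :
    ContOn t fun s x => f s x ^ k :=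
  contOn_iff_tendsto.mpr fun s hs x => (contOn_iff_tendsto.mp hf s hs x).pow k

theorem ContOn.sum {ι : Type*} (I : Finset ι) {t : ℝ} {f : ι → ℝ → D0 d → ℝ}
    (hf : ∀ i, ContOn t (f i)) : ContOn t fun s x => ∑ i ∈ I, f i s x :=
  contOn_iff_tendsto.mpr fun s hs x =>
    tendsto_finsetSum I fun i _ => contOn_iff_tendsto.mp (hf i) s hs x

theorem ContOn.congr {t : ℝ} {f g : ℝ → D0 d → ℝ} (hf : ContOn t f)
    (h : ∀ s, t ≤ s → ∀ x, g s x = f s x) : ContOn t g := by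
  intro s hs x ε hε
  obtain ⟨δ, hδ, H⟩ := hf s hs x ε hε
  exact ⟨δ, hδ, fun l hl y hd => by rw [h l hl, h s hs]; exact H l hl y hd⟩

theorem ContOn.mono {t t' : ℝ} {f : ℝ → D0 d → ℝ} (hf : ContOn t f) (h : t ≤ t') :
    ContOn t' f := by
  intro s hs x ε hε
  obtain ⟨δ, hδ, H⟩ := hf s (h.trans hs) x ε hε
  exact ⟨δ, hδ, fun l hl y hd => H l (h.trans hl) y hd⟩

/-- A series of continuous functionals, dominated on bounded sets, is continuous. -/
theorem ContOn.tsum {t : ℝ} {f : ℕ → ℝ → D0 d → ℝ} (hf : ∀ i, ContOn t (f i)) {c : ℕ → ℝ}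
    (hc : Summable c) {C : ℝ} {k : ℕ} (hc0 : ∀ i, 0 ≤ c i) (hC : 0 ≤ C)
    (hb : ∀ i s, t ≤ s → ∀ x : D0 d, |f i s x| ≤ C * (1 + |s| + supNorm x) ^ k) :
    ContOn t fun s x => ∑' i, c i * f i s x := by
  refine contOn_iff_tendsto.mpr fun s hs x => ?_
  refine tendsto_tsum_of_dominated_convergence
    (bound := fun i => c i * (C * (1 + (|s| + 1) + (supNorm x + 1)) ^ k))
    (hc.mul_right _) (fun i => (contOn_iff_tendsto.mp (hf i) s hs x).const_mul (c i)) ?_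
  filter_upwards [(pathNhds_hasBasis t s x).mem_of_mem one_pos] with p hp i
  rw [norm_mul, Real.norm_eq_abs, Real.norm_eq_abs, abs_of_nonneg (hc0 i)]
  refine mul_le_mul_of_nonneg_left ((hb i p.1 hp.1 p.2).trans ?_) (hc0 i)
  have h1 := abs_le_dInfty s x p.1 p.2
  have h2 := supNorm_le_add_dInfty s x p.1 p.2
  have h3 := abs_sub_abs_le_abs_sub p.1 s
  have h4 := supNorm_nonneg p.2
  have h5 := hp.2
  gcongr
  · linarith
  · linarith

/-! ### A smooth gauge equivalent to the sixth power of the supremum norm -/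

/-- The exponent is at least 2, so both one-sided derivatives at the kink vanish and glue. The cases
`k = 1` and `k = 0` give the first and second derivatives of the gauge. -/
theorem hasDerivAt_max_zero_pow (k : ℕ) (r : ℝ) :
    HasDerivAt (fun r : ℝ => max r 0 ^ (k + 2)) ((k + 2 : ℕ) * max r 0 ^ (k + 1)) r := by
  rcases lt_trichotomy r 0 with h | rfl | h
  · rw [max_eq_right h.le, zero_pow (by simp), mul_zero]
    refine (hasDerivAt_const r (0 : ℝ)).congr_of_eventuallyEq ?_
    filter_upwards [eventually_lt_nhds h] with q hq
    rw [max_eq_right hq.le, zero_pow (by simp)]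
  · rw [max_self, zero_pow (by simp), mul_zero, ← hasDerivWithinAt_univ, ← Set.Iic_union_Ici (a := (0 : ℝ))]
    refine HasDerivWithinAt.union ?_ ?_
    · refine (hasDerivWithinAt_const (0 : ℝ) _ (0 : ℝ)).congr (fun q hq => ?_) (by simp)
      rw [max_eq_right hq, zero_pow (by simp)]
    · have h := (hasDerivAt_pow (k + 2) (0 : ℝ)).hasDerivWithinAt (s := Set.Ici 0)
      rw [show k + 2 - 1 = k + 1 from rfl, zero_pow (by simp), mul_zero] at h
      exact h.congr (fun q hq => by rw [max_eq_left hq]) (by simp)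
  · rw [max_eq_left h.le]
    refine (hasDerivAt_pow (k + 2) r).congr_of_eventuallyEq ?_
    filter_upwards [eventually_gt_nhds h] with q hq
    rw [max_eq_left hq.le]

/-- The supremum of `|x(θ)|` over `θ < 0`. -/
def pastSup (x : D0 d) : ℝ := ⨆ θ : Past, if θ = now then 0 else ‖(x : Past → E d) θ‖

theorem pastSup_bddAbove (x : D0 d) :
    BddAbove (Set.range fun θ : Past => if θ = now then 0 else ‖(x : Past → E d) θ‖) := by
  refine ⟨supNorm x, ?_⟩
  rintro _ ⟨θ, rfl⟩
  dsimp only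
  split_ifs
  · exact supNorm_nonneg x
  · exact le_supNorm x θ

theorem supNorm_eq_max (x : D0 d) : supNorm x = max (pastSup x) ‖(x : Past → E d) now‖ := by
  have : Nonempty Past := ⟨now⟩
  refine le_antisymm (supNorm_le fun θ => ?_) (max_le (ciSup_le fun θ => ?_) (le_supNorm x now))
  · by_cases h : θ = now
    · rw [h]; exact le_max_right _ _
    · refine le_max_of_le_left ?_
      have := le_ciSup (pastSup_bddAbove x) θ
      rwa [if_neg h] at this
  · split_ifs
    · exact supNorm_nonneg x
    · exact le_supNorm x θ

theorem pastSup_nonneg (x : D0 d) : 0 ≤ pastSup x := by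
  have := le_ciSup (pastSup_bddAbove x) now
  rwa [if_pos rfl] at this

theorem bump_now (i : Fin d) : (bump i : Past → E d) now = EuclideanSpace.single i (1 : ℝ) :=
  if_pos rfl

theorem pastSup_add_bump (x : D0 d) (i : Fin d) (h : ℝ) :
    pastSup (x + h • bump i) = pastSup x := by
  unfold pastSup
  congr 1
  ext θ
  split_ifs with hθ
  · rfl
  · change ‖(x : Past → E d) θ + h • (if θ = now then EuclideanSpace.single i (1 : ℝ) else 0)‖ = _
    rw [if_neg hθ, smul_zero, add_zero]

theorem supNorm_add_smul_bump_le (x : D0 d) (i : Fin d) (h : ℝ) :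
    supNorm (x + h • bump i) ≤ supNorm x + |h| := by
  refine (supNorm_add_le _ _).trans (add_le_add_right (supNorm_le fun θ => ?_) _)
  change ‖h • (if θ = now then EuclideanSpace.single i (1 : ℝ) else (0 : E d))‖ ≤ _
  split_ifs
  · simp [norm_smul]
  · simp

/-- The squared modulus `|x(0)|²` of the present state. -/
def nowSq (x : D0 d) : ℝ := ‖(x : Past → E d) now‖ ^ 2

theorem nowSq_nonneg (x : D0 d) : 0 ≤ nowSq x := sq_nonneg _

theorem nowSq_le (x : D0 d) : nowSq x ≤ supNorm x ^ 2 :=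
  pow_le_pow_left₀ (norm_nonneg _) (le_supNorm x now) 2

theorem nowSq_eq_sum (x : D0 d) : nowSq x = ∑ i, (x : Past → E d) now i ^ 2 := by
  simp [nowSq, EuclideanSpace.norm_sq_eq]

theorem abs_now_le (x : D0 d) (i : Fin d) : |(x : Past → E d) now i| ≤ supNorm x :=
  (PiLp.norm_apply_le ((x : Past → E d) now) i).trans (le_supNorm x now)

theorem add_bump_now (x : D0 d) (i j : Fin d) (h : ℝ) :
    ((x + h • bump i : D0 d) : Past → E d) now j =
      (x : Past → E d) now j + h * (if i = j then 1 else 0) := by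
  change (x : Past → E d) now j + h * (bump i : Past → E d) now j = _
  rw [bump_now, PiLp.single_apply]
  simp [eq_comm]

theorem nowSq_add_bump (x : D0 d) (i : Fin d) (h : ℝ) :
    nowSq (x + h • bump i) = nowSq x + 2 * h * (x : Past → E d) now i + h ^ 2 := by
  simp only [nowSq_eq_sum, add_bump_now, add_sq, Finset.sum_add_distrib]
  congr 1
  · congr 1
    simp only [mul_ite, mul_one, mul_zero, Finset.sum_ite_eq, Finset.mem_univ, if_true]
    ring
  · simp [ite_pow]

/-- The source of the gauge's smoothness: a bump leaves `pastSup` unchanged, so vertically this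
quantity is the positive part of a quadratic polynomial in the bump size. -/
theorem supNorm_sq_sub_nowSq (x : D0 d) :
    supNorm x ^ 2 - nowSq x = max (pastSup x ^ 2 - nowSq x) 0 := by
  have h1 := pastSup_nonneg x
  have h2 := norm_nonneg ((x : Past → E d) now)
  rw [supNorm_eq_max]
  unfold nowSq
  rcases le_total (pastSup x) ‖(x : Past → E d) now‖ with h | h
  · rw [max_eq_right h, max_eq_right, sub_self]
    nlinarith
  · rw [max_eq_left h, max_eq_left]
    nlinarith

/-- The gauge `(|x|_C² - |x(0)|²)³ + |x(0)|⁶`. -/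
def gauge (x : D0 d) : ℝ := (supNorm x ^ 2 - nowSq x) ^ 3 + nowSq x ^ 3

/-- The vertical gradient of the gauge. -/
def gaugeGrad (i : Fin d) (x : D0 d) : ℝ :=
  6 * supNorm x ^ 2 * (2 * nowSq x - supNorm x ^ 2) * (x : Past → E d) now i

/-- The vertical Hessian of the gauge. -/
def gaugeHess (i j : Fin d) (x : D0 d) : ℝ :=
  24 * supNorm x ^ 2 * (x : Past → E d) now i * (x : Past → E d) now j +
    6 * supNorm x ^ 2 * (2 * nowSq x - supNorm x ^ 2) * (if i = j then 1 else 0)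

theorem hasDerivAt_nowSq (x : D0 d) (i : Fin d) :
    HasDerivAt (fun h : ℝ => nowSq (x + h • bump i)) (2 * (x : Past → E d) now i) 0 := by
  simp only [nowSq_add_bump]
  have h := (((hasDerivAt_id (0 : ℝ)).const_mul 2).mul_const ((x : Past → E d) now i)).add
    (hasDerivAt_pow 2 (0 : ℝ))
  convert! h.const_add (nowSq x) using 1
  · ext h; simp [add_assoc]
  · simp

theorem hasDerivAt_supNorm_sq_sub_pow (x : D0 d) (i : Fin d) (k : ℕ) :
    HasDerivAt (fun h : ℝ => (supNorm (x + h • bump i) ^ 2 - nowSq (x + h • bump i)) ^ (k + 2))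
      ((k + 2 : ℕ) * (supNorm x ^ 2 - nowSq x) ^ (k + 1) * (-(2 * (x : Past → E d) now i))) 0 := by
  simp only [supNorm_sq_sub_nowSq, pastSup_add_bump]
  have h1 := (hasDerivAt_nowSq x i).const_sub (pastSup x ^ 2)
  have h2 := hasDerivAt_max_zero_pow k (pastSup x ^ 2 - nowSq (x + (0 : ℝ) • bump i))
  have h3 := h2.comp (0 : ℝ) h1
  rw [zero_smul, add_zero] at h3
  exact h3

theorem hasDerivAt_gauge (x : D0 d) (i : Fin d) :
    HasDerivAt (fun h : ℝ => gauge (x + h • bump i)) (gaugeGrad i x) 0 := by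
  have h := (hasDerivAt_supNorm_sq_sub_pow x i 1).add ((hasDerivAt_nowSq x i).pow 3)
  convert! h using 1
  simp only [zero_smul, add_zero, gaugeGrad]
  push_cast
  ring

/-- In this form the gradient involves only squares of `nowSq` and of the positive part, each
already known to be vertically differentiable. -/
theorem gaugeGrad_eq (i : Fin d) (x : D0 d) : gaugeGrad i x =
    6 * (nowSq x ^ 2 - (supNorm x ^ 2 - nowSq x) ^ 2) * (x : Past → E d) now i := by
  unfold gaugeGrad
  ring

theorem hasDerivAt_gaugeGrad (x : D0 d) (i j : Fin d) :
    HasDerivAt (fun h : ℝ => gaugeGrad j (x + h • bump i)) (gaugeHess i j x) 0 := by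
  simp only [gaugeGrad_eq]
  have h0 : HasDerivAt (fun h : ℝ => ((x + h • bump i : D0 d) : Past → E d) now j)
      (if i = j then 1 else 0) 0 := by
    simp only [add_bump_now]
    simpa using ((hasDerivAt_id (0 : ℝ)).mul_const (if i = j then (1 : ℝ) else 0)).const_add
      ((x : Past → E d) now j)
  have h := ((((hasDerivAt_nowSq x i).pow 2).sub
    (hasDerivAt_supNorm_sq_sub_pow x i 0)).const_mul 6).mul h0
  convert! h using 1
  simp only [zero_smul, add_zero, gaugeHess, Pi.sub_apply, Pi.pow_apply]
  push_cast
  ring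

theorem gauge_nonneg (x : D0 d) : 0 ≤ gauge x :=
  add_nonneg (pow_nonneg (sub_nonneg.mpr (nowSq_le x)) 3) (pow_nonneg (nowSq_nonneg x) 3)

theorem gauge_le (x : D0 d) : gauge x ≤ supNorm x ^ 6 := by
  have h1 := sub_nonneg.mpr (nowSq_le x)
  have h2 := nowSq_nonneg x
  have h3 : supNorm x ^ 6 = ((supNorm x ^ 2 - nowSq x) + nowSq x) ^ 3 := by ring
  rw [h3, gauge]
  generalize supNorm x ^ 2 - nowSq x = a at *
  have := mul_nonneg (mul_nonneg h1 h2) (add_nonneg h1 h2)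
  nlinarith

/-- For `a, b ≥ 0`, `4(a³ + b³) - (a + b)³ = 3(a + b)(a - b)²`, which is nonnegative. -/
theorem supNorm_pow_le_gauge (x : D0 d) : supNorm x ^ 6 ≤ 4 * gauge x := by
  have h1 := sub_nonneg.mpr (nowSq_le x)
  have h2 := nowSq_nonneg x
  have h3 : supNorm x ^ 6 = ((supNorm x ^ 2 - nowSq x) + nowSq x) ^ 3 := by ring
  rw [h3, gauge]
  generalize supNorm x ^ 2 - nowSq x = a at *
  have := mul_nonneg (add_nonneg h1 h2) (sq_nonneg (a - nowSq x))
  nlinarith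

theorem abs_two_mul_nowSq_sub_le (x : D0 d) : |2 * nowSq x - supNorm x ^ 2| ≤ supNorm x ^ 2 := by
  have h1 := nowSq_le x
  have h2 := nowSq_nonneg x
  rw [abs_le]
  constructor <;> linarith

theorem abs_gaugeGrad_le (i : Fin d) (x : D0 d) : |gaugeGrad i x| ≤ 6 * supNorm x ^ 5 := by
  have h0 := supNorm_nonneg x
  rw [gaugeGrad, abs_mul, abs_mul, abs_of_nonneg (by positivity : 0 ≤ 6 * supNorm x ^ 2)]
  calc _ ≤ 6 * supNorm x ^ 2 * supNorm x ^ 2 * supNorm x := by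
        gcongr
        · exact abs_two_mul_nowSq_sub_le x
        · exact abs_now_le x i
    _ = _ := by ring

theorem abs_gaugeHess_le (i j : Fin d) (x : D0 d) : |gaugeHess i j x| ≤ 30 * supNorm x ^ 4 := by
  have h0 := supNorm_nonneg x
  have h1 : |(if i = j then (1 : ℝ) else 0)| ≤ 1 := by split_ifs <;> simp
  refine (abs_add_le _ _).trans ?_
  rw [abs_mul, abs_mul, abs_mul (6 * supNorm x ^ 2 * _), abs_mul (6 * supNorm x ^ 2),
    abs_of_nonneg (by positivity : 0 ≤ 24 * supNorm x ^ 2),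
    abs_of_nonneg (by positivity : 0 ≤ 6 * supNorm x ^ 2)]
  calc _ ≤ 24 * supNorm x ^ 2 * supNorm x * supNorm x +
          6 * supNorm x ^ 2 * supNorm x ^ 2 * 1 := by
        gcongr
        · exact abs_now_le x i
        · exact abs_now_le x j
        · exact abs_two_mul_nowSq_sub_le x
    _ = _ := by ring

theorem nowSq_freeze (x : D0 d) {h : ℝ} (hh : 0 ≤ h) : nowSq (freeze x h) = nowSq x := by
  rw [nowSq, nowSq, freeze_now x hh]

theorem gauge_freeze (x : D0 d) {h : ℝ} (hh : 0 ≤ h) : gauge (freeze x h) = gauge x := by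
  rw [gauge, gauge, supNorm_freeze x hh, nowSq_freeze x hh]

theorem supNorm_zero : supNorm (0 : D0 d) = 0 :=
  le_antisymm (supNorm_le fun θ => by simp) (supNorm_nonneg _)

theorem gauge_zero : gauge (0 : D0 d) = 0 :=
  le_antisymm ((gauge_le 0).trans (by rw [supNorm_zero]; simp)) (gauge_nonneg 0)

/-! ### The penalty attached to a point of `[t, ∞) × 𝒟₀` -/

/-- The displacement at `(s, x)` from the frozen continuation of `(l, a)`. -/
def displ (z : ℝ × D0 d) (s : ℝ) (x : D0 d) : D0 d := x - freeze z.2 (s - z.1)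

/-- The penalty `|s - l|² + Υ(x - a_{s-l})`. -/
def penalty (z : ℝ × D0 d) (s : ℝ) (x : D0 d) : ℝ := (s - z.1) ^ 2 + gauge (displ z s x)

theorem displ_add_bump (z : ℝ × D0 d) (s : ℝ) (x : D0 d) (i : Fin d) (h : ℝ) :
    displ z s (x + h • bump i) = displ z s x + h • bump i := by
  unfold displ
  abel

/-- Freezing is a semigroup in nonnegative times, hence `z.1 ≤ s`. As the gauge is invariant under
freezing, horizontally a penalty varies only through its quadratic time term. -/
theorem displ_freeze (z : ℝ × D0 d) {s : ℝ} (hs : z.1 ≤ s) (x : D0 d) (h : ℝ) :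
    displ z (s + h) (freeze x h) = freeze (displ z s x) h := by
  unfold displ
  rw [freeze_sub, freeze_freeze _ _ (sub_nonneg.mpr hs)]
  congr 2
  ring

theorem penalty_nonneg (z : ℝ × D0 d) (s : ℝ) (x : D0 d) : 0 ≤ penalty z s x :=
  add_nonneg (sq_nonneg _) (gauge_nonneg _)

theorem penalty_self (z : ℝ × D0 d) : penalty z z.1 z.2 = 0 := by
  simp [penalty, displ, freeze_zero, gauge_zero]

theorem supNorm_freeze_le (x : D0 d) (h : ℝ) : supNorm (freeze x h) ≤ supNorm x :=
  supNorm_le fun _ => le_supNorm x _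

theorem supNorm_displ_le (z : ℝ × D0 d) (s : ℝ) (x : D0 d) :
    supNorm (displ z s x) ≤ supNorm x + supNorm z.2 :=
  (supNorm_sub_le _ _).trans (add_le_add_right (supNorm_freeze_le _ _) _)

/-- Freezing both displacements up to the later of the two times keeps their norms and makes the two
frozen copies of the centre equal, so they cancel. What remains is bounded by `d_∞`. -/
theorem contOn_supNorm_displ {t : ℝ} (z : ℝ × D0 d) (hz : z.1 ≤ t) :
    ContOn t fun s x => supNorm (displ z s x) := by
  refine ContOn.of_lipschitz fun s hs x l hl y => ?_
  have e1 := displ_freeze z (hz.trans hs) x (max (l - s) 0)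
  have e2 := displ_freeze z (hz.trans hl) y (max (s - l) 0)
  have e3 : s + max (l - s) 0 = l + max (s - l) 0 := by
    rcases le_total s l with h | h
    · rw [max_eq_left (by linarith), max_eq_right (by linarith)]; ring
    · rw [max_eq_right (by linarith), max_eq_left (by linarith)]; ring
  rw [← supNorm_freeze (displ z s x) (le_max_right (l - s) 0),
    ← supNorm_freeze (displ z l y) (le_max_right (s - l) 0), ← e1, ← e2, e3, abs_sub_comm]
  refine (abs_supNorm_sub_supNorm_le _ _).trans ?_
  unfold displ dInfty
  rw [sub_sub_sub_cancel_right]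
  exact le_add_of_nonneg_left (abs_nonneg _)

theorem contOn_displ_now {t : ℝ} (z : ℝ × D0 d) (hz : z.1 ≤ t) (i : Fin d) :
    ContOn t fun s x => (displ z s x : Past → E d) now i := by
  have key : ∀ s, t ≤ s → ∀ x : D0 d, (displ z s x : Past → E d) now i =
      (x : Past → E d) now i - (z.2 : Past → E d) now i := by
    intro s hs x
    change (x : Past → E d) now i - (freeze z.2 (s - z.1) : Past → E d) now i = _
    rw [freeze_now z.2 (by linarith)]
  refine ContOn.of_lipschitz fun s hs x l hl y => ?_
  rw [key s hs, key l hl, sub_sub_sub_cancel_right]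
  exact abs_apply_now_sub_le s x l y i

theorem contOn_nowSq_displ {t : ℝ} (z : ℝ × D0 d) (hz : z.1 ≤ t) :
    ContOn t fun s x => nowSq (displ z s x) := by
  simp only [nowSq_eq_sum]
  exact ContOn.sum _ fun i => (contOn_displ_now z hz i).pow 2

theorem contOn_time (t c : ℝ) : ContOn t fun s (_ : D0 d) => s - c :=
  ContOn.of_lipschitz fun s _ x l _ y => by
    rw [sub_sub_sub_cancel_right]
    exact abs_le_dInfty s x l y

theorem contOn_penalty {t : ℝ} (z : ℝ × D0 d) (hz : z.1 ≤ t) : ContOn t (penalty z) :=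
  ((contOn_time t z.1).pow 2).add
    (((((contOn_supNorm_displ z hz).pow 2).sub (contOn_nowSq_displ z hz)).pow 3).add
      ((contOn_nowSq_displ z hz).pow 3))

theorem contOn_gaugeGrad {t : ℝ} (z : ℝ × D0 d) (hz : z.1 ≤ t) (i : Fin d) :
    ContOn t fun s x => gaugeGrad i (displ z s x) :=
  (((ContOn.const t 6).mul ((contOn_supNorm_displ z hz).pow 2)).mul
    (((ContOn.const t 2).mul (contOn_nowSq_displ z hz)).sub
      ((contOn_supNorm_displ z hz).pow 2))).mul (contOn_displ_now z hz i)

theorem contOn_gaugeHess {t : ℝ} (z : ℝ × D0 d) (hz : z.1 ≤ t) (i j : Fin d) :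
    ContOn t fun s x => gaugeHess i j (displ z s x) :=
  ((((ContOn.const t 24).mul ((contOn_supNorm_displ z hz).pow 2)).mul
    (contOn_displ_now z hz i)).mul (contOn_displ_now z hz j)).add
  ((((ContOn.const t 6).mul ((contOn_supNorm_displ z hz).pow 2)).mul
    (((ContOn.const t 2).mul (contOn_nowSq_displ z hz)).sub
      ((contOn_supNorm_displ z hz).pow 2))).mul (ContOn.const t _))

/-! ### Series of penalties -/

theorem summable_half_pow : Summable fun m : ℕ => (1 / 2 : ℝ) ^ m := summable_geometric_two

theorem summable_half_pow_mul {a : ℕ → ℝ} {A : ℝ} (h : ∀ m, |a m| ≤ A) :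
    Summable fun m : ℕ => (1 / 2 : ℝ) ^ m * a m :=
  Summable.of_norm_bounded (summable_half_pow.mul_right A) fun m => by
    rw [norm_mul, Real.norm_eq_abs, Real.norm_eq_abs, abs_of_nonneg (by positivity)]
    gcongr
    exact h m

theorem abs_tsum_half_pow_mul_le {a : ℕ → ℝ} {A : ℝ} (h : ∀ m, |a m| ≤ A) :
    |∑' m : ℕ, (1 / 2 : ℝ) ^ m * a m| ≤ 2 * A := by
  rw [← Real.norm_eq_abs]
  refine tsum_of_norm_bounded (hasSum_geometric_two.mul_right A) fun m => ?_
  rw [norm_mul, Real.norm_eq_abs, Real.norm_eq_abs, abs_of_nonneg (by positivity)]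
  gcongr
  exact h m

theorem hasDerivAt_along_bump {f g : D0 d → ℝ} {i : Fin d}
    (hf : ∀ x, HasDerivAt (fun h : ℝ => f (x + h • bump i)) (g x) 0) (x : D0 d) (h : ℝ) :
    HasDerivAt (fun h : ℝ => f (x + h • bump i)) (g (x + h • bump i)) h := by
  have h1 := hf (x + h • bump i)
  rw [← sub_self h] at h1
  refine (h1.comp_sub_const h h).congr_of_eventuallyEq (Eventually.of_forall fun k => ?_)
  dsimp only
  rw [add_assoc, ← add_smul, add_sub_cancel]

/-- Termwise differentiation for `|h| < 1`, where the norm grows by at most 1 and the polynomial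
bound on the derivatives gives a summable majorant. The constant `S` stands for `1 + |s|`. -/
theorem hasDerivAt_bump_tsum {f g : ℕ → D0 d → ℝ} {i : Fin d} {C S : ℝ} {k : ℕ} (hC : 0 ≤ C)
    (hS : 0 ≤ S)
    (hf : ∀ m x, HasDerivAt (fun h : ℝ => f m (x + h • bump i)) (g m x) 0)
    (bf : ∀ m x, |f m x| ≤ C * (S + supNorm x) ^ k)
    (bg : ∀ m x, |g m x| ≤ C * (S + supNorm x) ^ k) (x : D0 d) :
    HasDerivAt (fun h : ℝ => ∑' m : ℕ, (1 / 2 : ℝ) ^ m * f m (x + h • bump i))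
      (∑' m : ℕ, (1 / 2 : ℝ) ^ m * g m x) 0 := by
  have h := hasDerivAt_tsum_of_isPreconnected
    (u := fun m : ℕ => (1 / 2 : ℝ) ^ m * (C * (S + (supNorm x + 1)) ^ k))
    (g := fun m h => (1 / 2 : ℝ) ^ m * f m (x + h • bump i))
    (g' := fun m h => (1 / 2 : ℝ) ^ m * g m (x + h • bump i))
    (t := Metric.ball (0 : ℝ) 1) (y₀ := 0) (y := 0)
    (summable_half_pow.mul_right _) Metric.isOpen_ball (convex_ball 0 1).isPreconnected
    (fun m h _ => (hasDerivAt_along_bump (hf m) x h).const_mul _)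
    (fun m h hh => ?_) (Metric.mem_ball_self one_pos)
    (summable_half_pow_mul (fun m => bf m _)) (Metric.mem_ball_self one_pos)
  · simpa only [zero_smul, add_zero] using h
  · rw [norm_mul, Real.norm_eq_abs, Real.norm_eq_abs, abs_of_nonneg (by positivity)]
    rw [mem_ball_zero_iff, Real.norm_eq_abs] at hh
    have h1 := supNorm_add_smul_bump_le x i h
    have h2 := supNorm_nonneg (x + h • bump i)
    refine mul_le_mul_of_nonneg_left ((bg m _).trans ?_) (by positivity)
    gcongr
    linarith

/-- The weighted series of the penalties attached to a sequence of points. -/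
def penaltySum (z : ℕ → ℝ × D0 d) (s : ℝ) (x : D0 d) : ℝ :=
  ∑' m : ℕ, (1 / 2 : ℝ) ^ m * penalty (z m) s x

section Bounds

variable {z : ℕ → ℝ × D0 d} {B : ℝ}

theorem abs_sub_le_of_bound (h1 : ∀ m, |(z m).1| ≤ B) (m : ℕ) (s : ℝ) (x : D0 d) :
    |s - (z m).1| ≤ (1 + B) * (1 + |s| + supNorm x) := by
  have hB : 0 ≤ B := (abs_nonneg _).trans (h1 m)
  have h0 := supNorm_nonneg x
  have h2 := abs_sub s (z m).1
  have h3 := h1 m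
  have h4 := mul_nonneg hB (add_nonneg (abs_nonneg s) h0)
  nlinarith

theorem supNorm_displ_le_of_bound (h2 : ∀ m, supNorm (z m).2 ≤ B) (m : ℕ) (s : ℝ) (x : D0 d) :
    supNorm (displ (z m) s x) ≤ (1 + B) * (1 + |s| + supNorm x) := by
  have hB : 0 ≤ B := (supNorm_nonneg _).trans (h2 m)
  have h0 := supNorm_nonneg x
  have h3 := supNorm_displ_le (z m) s x
  have h4 := h2 m
  have h5 := mul_nonneg hB (add_nonneg (abs_nonneg s) h0)
  have h6 := abs_nonneg s
  nlinarith

theorem one_le_bound (hB : 0 ≤ B) (s : ℝ) (x : D0 d) :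
    1 ≤ (1 + B) * (1 + |s| + supNorm x) :=
  one_le_mul_of_one_le_of_one_le (by linarith)
    (by have := supNorm_nonneg x; have := abs_nonneg s; linarith)

/-- One majorant serves the penalty and all its derivatives: the base is at least 1, so lower powers
are absorbed by the sixth, and 30 is the constant of the Hessian bound. -/
theorem abs_penalty_le (h1 : ∀ m, |(z m).1| ≤ B) (h2 : ∀ m, supNorm (z m).2 ≤ B) (m : ℕ) (s : ℝ)
    (x : D0 d) : |penalty (z m) s x| ≤ 30 * (1 + B) ^ 6 * (1 + |s| + supNorm x) ^ 6 := by
  have hX := one_le_bound ((supNorm_nonneg _).trans (h2 m)) s x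
  have ha := abs_sub_le_of_bound h1 m s x
  have hb := supNorm_displ_le_of_bound h2 m s x
  rw [abs_of_nonneg (penalty_nonneg _ _ _), mul_assoc, ← mul_pow, penalty, ← sq_abs]
  generalize (1 + B) * (1 + |s| + supNorm x) = X at *
  have h3 : |s - (z m).1| ^ 2 ≤ X ^ 6 :=
    (pow_le_pow_left₀ (abs_nonneg _) ha 2).trans (pow_le_pow_right₀ hX (by norm_num))
  have h4 := (gauge_le (displ (z m) s x)).trans (pow_le_pow_left₀ (supNorm_nonneg _) hb 6)
  have : 0 ≤ X ^ 6 := by positivity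
  linarith

theorem abs_horiz_le (h1 : ∀ m, |(z m).1| ≤ B) (m : ℕ) (s : ℝ)
    (x : D0 d) : |2 * (s - (z m).1)| ≤ 30 * (1 + B) ^ 6 * (1 + |s| + supNorm x) ^ 6 := by
  have hX := one_le_bound ((abs_nonneg _).trans (h1 m)) s x
  have ha := abs_sub_le_of_bound h1 m s x
  rw [abs_mul, abs_two, mul_assoc, ← mul_pow]
  generalize (1 + B) * (1 + |s| + supNorm x) = X at *
  have h3 : X ≤ X ^ 6 := le_self_pow₀ hX (by norm_num)
  linarith

theorem abs_gaugeGrad_displ_le (h2 : ∀ m, supNorm (z m).2 ≤ B) (i : Fin d) (m : ℕ) (s : ℝ)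
    (x : D0 d) : |gaugeGrad i (displ (z m) s x)| ≤
      30 * (1 + B) ^ 6 * (1 + |s| + supNorm x) ^ 6 := by
  have hX := one_le_bound ((supNorm_nonneg _).trans (h2 m)) s x
  have hb := supNorm_displ_le_of_bound h2 m s x
  rw [mul_assoc, ← mul_pow]
  generalize (1 + B) * (1 + |s| + supNorm x) = X at *
  have h3 : supNorm (displ (z m) s x) ^ 5 ≤ X ^ 6 :=
    (pow_le_pow_left₀ (supNorm_nonneg _) hb 5).trans (pow_le_pow_right₀ hX (by norm_num))
  have h4 := abs_gaugeGrad_le i (displ (z m) s x)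
  have : 0 ≤ X ^ 6 := by positivity
  linarith

theorem abs_gaugeHess_displ_le (h2 : ∀ m, supNorm (z m).2 ≤ B) (i j : Fin d) (m : ℕ) (s : ℝ)
    (x : D0 d) : |gaugeHess i j (displ (z m) s x)| ≤
      30 * (1 + B) ^ 6 * (1 + |s| + supNorm x) ^ 6 := by
  have hX := one_le_bound ((supNorm_nonneg _).trans (h2 m)) s x
  have hb := supNorm_displ_le_of_bound h2 m s x
  rw [mul_assoc, ← mul_pow]
  generalize (1 + B) * (1 + |s| + supNorm x) = X at *
  have h3 : supNorm (displ (z m) s x) ^ 4 ≤ X ^ 6 :=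
    (pow_le_pow_left₀ (supNorm_nonneg _) hb 4).trans (pow_le_pow_right₀ hX (by norm_num))
  have h4 := abs_gaugeHess_le i j (displ (z m) s x)
  linarith

theorem summable_penalty (h1 : ∀ m, |(z m).1| ≤ B) (h2 : ∀ m, supNorm (z m).2 ≤ B)
    (s : ℝ) (x : D0 d) : Summable fun m : ℕ => (1 / 2 : ℝ) ^ m * penalty (z m) s x :=
  summable_half_pow_mul fun m => abs_penalty_le h1 h2 m s x

theorem hasDerivAt_penaltySum (h1 : ∀ m, |(z m).1| ≤ B) (h2 : ∀ m, supNorm (z m).2 ≤ B)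
    (i : Fin d) (s : ℝ) (x : D0 d) :
    HasDerivAt (fun h : ℝ => penaltySum z s (x + h • bump i))
      (∑' m : ℕ, (1 / 2 : ℝ) ^ m * gaugeGrad i (displ (z m) s x)) 0 := by
  have hB : 0 ≤ B := (supNorm_nonneg _).trans (h2 0)
  refine hasDerivAt_bump_tsum (f := fun m x => penalty (z m) s x)
    (g := fun m x => gaugeGrad i (displ (z m) s x)) (by positivity)
    (by positivity : 0 ≤ 1 + |s|) (fun m x => ?_) (fun m x => abs_penalty_le h1 h2 m s x)
    (fun m x => abs_gaugeGrad_displ_le h2 i m s x) x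
  simp only [penalty, displ_add_bump]
  exact (hasDerivAt_gauge _ i).const_add _

theorem vertDeriv_penaltySum (h1 : ∀ m, |(z m).1| ≤ B) (h2 : ∀ m, supNorm (z m).2 ≤ B)
    (i : Fin d) : vertDeriv i (penaltySum z) =
      fun s x => ∑' m : ℕ, (1 / 2 : ℝ) ^ m * gaugeGrad i (displ (z m) s x) := by
  funext s x
  exact (hasDerivAt_penaltySum h1 h2 i s x).deriv

theorem hasDerivAt_vertDeriv_penaltySum (h1 : ∀ m, |(z m).1| ≤ B)
    (h2 : ∀ m, supNorm (z m).2 ≤ B) (i j : Fin d) (s : ℝ) (x : D0 d) :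
    HasDerivAt (fun h : ℝ => vertDeriv j (penaltySum z) s (x + h • bump i))
      (∑' m : ℕ, (1 / 2 : ℝ) ^ m * gaugeHess i j (displ (z m) s x)) 0 := by
  have hB : 0 ≤ B := (supNorm_nonneg _).trans (h2 0)
  rw [vertDeriv_penaltySum h1 h2]
  refine hasDerivAt_bump_tsum (f := fun m x => gaugeGrad j (displ (z m) s x))
    (g := fun m x => gaugeHess i j (displ (z m) s x)) (by positivity)
    (by positivity : 0 ≤ 1 + |s|) (fun m x => ?_)
    (fun m x => abs_gaugeGrad_displ_le h2 j m s x)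
    (fun m x => abs_gaugeHess_displ_le h2 i j m s x) x
  simp only [displ_add_bump]
  exact hasDerivAt_gaugeGrad _ i j

theorem vertDeriv_vertDeriv_penaltySum (h1 : ∀ m, |(z m).1| ≤ B)
    (h2 : ∀ m, supNorm (z m).2 ≤ B) (i j : Fin d) :
    vertDeriv i (vertDeriv j (penaltySum z)) =
      fun s x => ∑' m : ℕ, (1 / 2 : ℝ) ^ m * gaugeHess i j (displ (z m) s x) := by
  funext s x
  exact (hasDerivAt_vertDeriv_penaltySum h1 h2 i j s x).deriv

theorem hasDerivWithinAt_penaltySum (h1 : ∀ m, |(z m).1| ≤ B) (h2 : ∀ m, supNorm (z m).2 ≤ B)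
    {s : ℝ} (hs : ∀ m, (z m).1 ≤ s) (x : D0 d) :
    HasDerivWithinAt (fun h : ℝ => penaltySum z (s + h) (freeze x h))
      (∑' m : ℕ, (1 / 2 : ℝ) ^ m * (2 * (s - (z m).1))) (Set.Ici 0) 0 := by
  -- For `h ≥ 0` the gauge terms do not depend on `h`. The series with these terms held fixed is
  -- differentiable on both sides of 0, and agrees with the penalty sum on `[0, ∞)`.
  have h := hasDerivAt_tsum_of_isPreconnected
    (u := fun m : ℕ => (1 / 2 : ℝ) ^ m * (2 * (|s| + 1 + B)))
    (g := fun m h => (1 / 2 : ℝ) ^ m * ((s + h - (z m).1) ^ 2 + gauge (displ (z m) s x)))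
    (g' := fun m h => (1 / 2 : ℝ) ^ m * (2 * (s + h - (z m).1)))
    (t := Metric.ball (0 : ℝ) 1) (y₀ := 0) (y := 0)
    (summable_half_pow.mul_right _) Metric.isOpen_ball (convex_ball 0 1).isPreconnected
    (fun m h _ => ?_) (fun m h hh => ?_) (Metric.mem_ball_self one_pos)
    (by simp only [add_zero]; exact summable_penalty h1 h2 s x) (Metric.mem_ball_self one_pos)
  · simp only [add_zero] at h
    refine h.hasDerivWithinAt.congr (fun h hh => ?_) ?_
    · unfold penaltySum penalty
      congr 1
      funext m
      rw [displ_freeze (z m) (hs m), gauge_freeze _ hh]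
    · unfold penaltySum penalty
      rw [freeze_zero, add_zero]
  · have e := ((((hasDerivAt_id h).const_add s).sub_const (z m).1).pow 2).add_const
      (gauge (displ (z m) s x))
    convert! e.const_mul ((1 / 2 : ℝ) ^ m) using 1
    simp
  · rw [norm_mul, Real.norm_eq_abs, Real.norm_eq_abs, abs_of_nonneg (by positivity), abs_mul,
      abs_two]
    rw [mem_ball_zero_iff, Real.norm_eq_abs] at hh
    gcongr
    have e1 := abs_sub (s + h) (z m).1
    have e2 := abs_add_le s h
    have e3 := h1 m
    linarith

theorem horizDeriv_penaltySum (h1 : ∀ m, |(z m).1| ≤ B) (h2 : ∀ m, supNorm (z m).2 ≤ B)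
    {s : ℝ} (hs : ∀ m, (z m).1 ≤ s) (x : D0 d) :
    horizDeriv (penaltySum z) s x = ∑' m : ℕ, (1 / 2 : ℝ) ^ m * (2 * (s - (z m).1)) :=
  (hasDerivWithinAt_penaltySum h1 h2 hs x).derivWithin (uniqueDiffOn_Ici 0 0 Set.self_mem_Ici)

theorem isC12p_penaltySum (h1 : ∀ m, |(z m).1| ≤ B) (h2 : ∀ m, supNorm (z m).2 ≤ B)
    {t : ℝ} (ht : ∀ m, (z m).1 ≤ t) : IsC12p t (penaltySum z) := by
  have hB : 0 ≤ B := (supNorm_nonneg _).trans (h2 0)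
  have hC : 0 ≤ 30 * (1 + B) ^ 6 := by positivity
  refine ⟨fun s hs x => (hasDerivWithinAt_penaltySum h1 h2 (fun m => (ht m).trans hs)
      x).differentiableWithinAt,
    fun i s _ x => (hasDerivAt_penaltySum h1 h2 i s x).differentiableAt,
    fun i j s _ x => (hasDerivAt_vertDeriv_penaltySum h1 h2 i j s x).differentiableAt,
    ?_, ?_, fun i => ?_, fun i j => ?_, ?_, ?_, fun i => ?_, fun i j => ?_⟩
  · exact ContOn.tsum (fun m => contOn_penalty (z m) (ht m)) summable_half_pow
      (fun m => by positivity) hC (fun m s _ x => abs_penalty_le h1 h2 m s x)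
  · refine (ContOn.tsum (f := fun m s _ => 2 * (s - (z m).1))
      (fun m => (ContOn.const t 2).mul (contOn_time t (z m).1))
      summable_half_pow (fun m => by positivity) hC (fun m s _ x => abs_horiz_le h1 m s x)).congr
      fun s hs x => horizDeriv_penaltySum h1 h2 (fun m => (ht m).trans hs) x
  · rw [vertDeriv_penaltySum h1 h2]
    exact ContOn.tsum (fun m => contOn_gaugeGrad (z m) (ht m) i) summable_half_pow
      (fun m => by positivity) hC (fun m s _ x => abs_gaugeGrad_displ_le h2 i m s x)
  · rw [vertDeriv_vertDeriv_penaltySum h1 h2]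
    exact ContOn.tsum (fun m => contOn_gaugeHess (z m) (ht m) i j) summable_half_pow
      (fun m => by positivity) hC (fun m s _ x => abs_gaugeHess_displ_le h2 i j m s x)
  · refine ⟨2 * (30 * (1 + B) ^ 6), 6, fun s _ x => ?_⟩
    rw [mul_assoc 2]
    exact abs_tsum_half_pow_mul_le fun m => abs_penalty_le h1 h2 m s x
  · refine ⟨2 * (30 * (1 + B) ^ 6), 6, fun s hs x => ?_⟩
    rw [mul_assoc 2, horizDeriv_penaltySum h1 h2 (fun m => (ht m).trans hs) x]
    exact abs_tsum_half_pow_mul_le fun m => abs_horiz_le h1 m s x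
  · refine ⟨2 * (30 * (1 + B) ^ 6), 6, fun s _ x => ?_⟩
    rw [mul_assoc 2, vertDeriv_penaltySum h1 h2]
    exact abs_tsum_half_pow_mul_le fun m => abs_gaugeGrad_displ_le h2 i m s x
  · refine ⟨2 * (30 * (1 + B) ^ 6), 6, fun s _ x => ?_⟩
    rw [mul_assoc 2, vertDeriv_vertDeriv_penaltySum h1 h2]
    exact abs_tsum_half_pow_mul_le fun m => abs_gaugeHess_displ_le h2 i j m s x

end Bounds

/-! ### Operations on the class `C_p^{1,2}` -/

theorem PolyGrowth.mono {t t' : ℝ} {f : ℝ → D0 d → ℝ} (hf : PolyGrowth t f) (h : t ≤ t') :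
    PolyGrowth t' f := by
  obtain ⟨C, k, H⟩ := hf
  exact ⟨C, k, fun s hs => H s (h.trans hs)⟩

theorem PolyGrowth.congr {t : ℝ} {f g : ℝ → D0 d → ℝ} (hf : PolyGrowth t f)
    (h : ∀ s, t ≤ s → ∀ x, g s x = f s x) : PolyGrowth t g := by
  obtain ⟨C, k, H⟩ := hf
  exact ⟨C, k, fun s hs x => by rw [h s hs]; exact H s hs x⟩

theorem PolyGrowth.add {t : ℝ} {f g : ℝ → D0 d → ℝ} (hf : PolyGrowth t f) (hg : PolyGrowth t g) :
    PolyGrowth t fun s x => f s x + g s x := by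
  obtain ⟨C, k, H⟩ := hf
  obtain ⟨D, l, K⟩ := hg
  refine ⟨|C| + |D|, max k l, fun s hs x => (abs_add_le _ _).trans ?_⟩
  have hX : 1 ≤ 1 + |s| + supNorm x := by
    have := supNorm_nonneg x
    have := abs_nonneg s
    linarith
  have hX0 : 0 ≤ 1 + |s| + supNorm x := zero_le_one.trans hX
  rw [add_mul]
  refine add_le_add ((H s hs x).trans ?_) ((K s hs x).trans ?_)
  · exact mul_le_mul (le_abs_self C) (pow_le_pow_right₀ hX (le_max_left _ _)) (by positivity)
      (abs_nonneg _)
  · exact mul_le_mul (le_abs_self D) (pow_le_pow_right₀ hX (le_max_right _ _)) (by positivity)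
      (abs_nonneg _)

theorem IsC12p.mono {t t' : ℝ} {f : ℝ → D0 d → ℝ} (hf : IsC12p t f) (h : t ≤ t') :
    IsC12p t' f :=
  ⟨fun s hs => hf.horiz_exists s (h.trans hs), fun i s hs => hf.vert_exists i s (h.trans hs),
    fun i j s hs => hf.vert2_exists i j s (h.trans hs), hf.cont.mono h, hf.cont_horiz.mono h,
    fun i => (hf.cont_vert i).mono h, fun i j => (hf.cont_vert2 i j).mono h, hf.growth.mono h,
    hf.growth_horiz.mono h, fun i => (hf.growth_vert i).mono h,
    fun i j => (hf.growth_vert2 i j).mono h⟩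

section Add

variable {t : ℝ} {f g : ℝ → D0 d → ℝ}

theorem IsC12p.horizDeriv_add (hf : IsC12p t f) (hg : IsC12p t g) {s : ℝ} (hs : t ≤ s)
    (x : D0 d) : horizDeriv (fun s x => f s x + g s x) s x = horizDeriv f s x + horizDeriv g s x :=
  derivWithin_fun_add (hf.horiz_exists s hs x) (hg.horiz_exists s hs x)

theorem IsC12p.vertDeriv_add (hf : IsC12p t f) (hg : IsC12p t g) (i : Fin d) {s : ℝ} (hs : t ≤ s)
    (x : D0 d) :
    vertDeriv i (fun s x => f s x + g s x) s x = vertDeriv i f s x + vertDeriv i g s x :=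
  deriv_fun_add (hf.vert_exists i s hs x) (hg.vert_exists i s hs x)

theorem IsC12p.vertDeriv_vertDeriv_add (hf : IsC12p t f) (hg : IsC12p t g) (i j : Fin d) {s : ℝ}
    (hs : t ≤ s) (x : D0 d) : vertDeriv i (vertDeriv j fun s x => f s x + g s x) s x =
      vertDeriv i (vertDeriv j f) s x + vertDeriv i (vertDeriv j g) s x := by
  refine Eq.trans ?_ (deriv_fun_add (hf.vert2_exists i j s hs x) (hg.vert2_exists i j s hs x))
  exact congrArg (fun u : ℝ → ℝ => deriv u 0) (funext fun h => hf.vertDeriv_add hg j hs _)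

theorem IsC12p.add (hf : IsC12p t f) (hg : IsC12p t g) :
    IsC12p t fun s x => f s x + g s x := by
  refine ⟨fun s hs x => (hf.horiz_exists s hs x).fun_add (hg.horiz_exists s hs x),
    fun i s hs x => (hf.vert_exists i s hs x).fun_add (hg.vert_exists i s hs x),
    fun i j s hs x => ?_, hf.cont.add hg.cont,
    (hf.cont_horiz.add hg.cont_horiz).congr fun s hs x => hf.horizDeriv_add hg hs x,
    fun i => ((hf.cont_vert i).add (hg.cont_vert i)).congr fun s hs x =>
      hf.vertDeriv_add hg i hs x,
    fun i j => ((hf.cont_vert2 i j).add (hg.cont_vert2 i j)).congr fun s hs x =>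
      hf.vertDeriv_vertDeriv_add hg i j hs x, hf.growth.add hg.growth,
    (hf.growth_horiz.add hg.growth_horiz).congr fun s hs x => hf.horizDeriv_add hg hs x,
    fun i => ((hf.growth_vert i).add (hg.growth_vert i)).congr fun s hs x =>
      hf.vertDeriv_add hg i hs x,
    fun i j => ((hf.growth_vert2 i j).add (hg.growth_vert2 i j)).congr fun s hs x =>
      hf.vertDeriv_vertDeriv_add hg i j hs x⟩
  simp only [hf.vertDeriv_add hg j hs]
  exact (hf.vert2_exists i j s hs x).fun_add (hg.vert2_exists i j s hs x)

end Add

theorem horizDeriv_const (c : ℝ) : horizDeriv (fun _ (_ : D0 d) => c) = fun _ _ => 0 := by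
  funext s x
  simp [horizDeriv]

theorem vertDeriv_const (i : Fin d) (c : ℝ) :
    vertDeriv i (fun _ (_ : D0 d) => c) = fun _ _ => 0 := by
  funext s x
  simp [vertDeriv]

theorem PolyGrowth.const (t c : ℝ) : PolyGrowth t fun _ (_ : D0 d) => c :=
  ⟨|c|, 0, fun s _ x => by simp⟩

theorem isC12p_const (t c : ℝ) : IsC12p t fun _ (_ : D0 d) => c := by
  refine ⟨?_, ?_, ?_, ?_, ?_, ?_, ?_, ?_, ?_, ?_, ?_⟩ <;>
    simp only [horizDeriv_const, vertDeriv_const, ContOn.const, PolyGrowth.const,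
      differentiableWithinAt_const, differentiableAt_const, implies_true]

/-! ### A smooth variational principle along a preorder -/

section Variational

variable {X : Type*}

/-- Successive approximate maximizers, each functional being penalized at the previous ones. -/
theorem exists_penalized_seq (R : X → X → Prop) (hrefl : ∀ z, R z z)
    (htrans : ∀ a b c, R a b → R b c → R a c) (F : X → ℝ) (ρ : X → X → ℝ)
    (hρ : ∀ z w, 0 ≤ ρ z w) (z₀ : X) {κ : ℝ} (hκ : 0 < κ)
    (hF : ∀ z, R z₀ z → F z ≤ F z₀ + κ) :
    ∃ (z : ℕ → X) (G : ℕ → X → ℝ), z 0 = z₀ ∧ (∀ w, G 0 w = F w - ρ z₀ w) ∧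
      ∀ i, R (z i) (z (i + 1)) ∧ G i (z i) ≤ G i (z (i + 1)) ∧
        (∀ w, R (z i) w → G i (z i) ≤ G i w → G i w ≤ G i (z (i + 1)) + κ * (1 / 4) ^ (i + 1)) ∧
        ∀ w, G (i + 1) w = G i w - (1 / 2) ^ (i + 1) * ρ (z (i + 1)) w := by
  -- The subtype carries the upper bound by `F z₀ + κ` on successors. It survives each penalization
  -- and keeps every supremum finite.
  have pick : ∀ (i : ℕ) (p : {p : X × (X → ℝ) // ∀ w, R p.1 w → p.2 w ≤ F z₀ + κ}),
      ∃ q : {p : X × (X → ℝ) // ∀ w, R p.1 w → p.2 w ≤ F z₀ + κ},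
        R p.1.1 q.1.1 ∧ p.1.2 p.1.1 ≤ p.1.2 q.1.1 ∧
        (∀ w, R p.1.1 w → p.1.2 p.1.1 ≤ p.1.2 w →
          p.1.2 w ≤ p.1.2 q.1.1 + κ * (1 / 4) ^ (i + 1)) ∧
        ∀ w, q.1.2 w = p.1.2 w - (1 / 2) ^ (i + 1) * ρ q.1.1 w := by
    rintro i ⟨⟨a, g⟩, hg⟩
    dsimp only at hg ⊢
    have hne : (g '' {w | R a w ∧ g a ≤ g w}).Nonempty := ⟨_, a, ⟨hrefl a, le_rfl⟩, rfl⟩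
    have hbdd : BddAbove (g '' {w | R a w ∧ g a ≤ g w}) :=
      ⟨F z₀ + κ, by rintro _ ⟨w, hw, rfl⟩; exact hg w hw.1⟩
    have htol : 0 < κ * (1 / 4) ^ (i + 1) := by positivity
    obtain ⟨_, ⟨b, ⟨hab, hgb⟩, rfl⟩, hb⟩ := exists_lt_of_lt_csSup hne (sub_lt_self _ htol)
    refine ⟨⟨(b, fun w => g w - (1 / 2) ^ (i + 1) * ρ b w), fun w hw => ?_⟩, hab, hgb,
      fun w hw hgw => ?_, fun w => rfl⟩
    · have h1 := hg w (htrans _ _ _ hab hw)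
      have h2 : 0 ≤ (1 / 2 : ℝ) ^ (i + 1) * ρ b w := mul_nonneg (by positivity) (hρ b w)
      dsimp only
      linarith
    · have := le_csSup hbdd ⟨w, ⟨hw, hgw⟩, rfl⟩
      linarith
  choose next hnext using pick
  let p : ℕ → {p : X × (X → ℝ) // ∀ w, R p.1 w → p.2 w ≤ F z₀ + κ} := fun i =>
    Nat.rec ⟨(z₀, fun w => F w - ρ z₀ w), fun w hw => by
      have := hF w hw
      have := hρ z₀ w
      dsimp only
      linarith⟩ (fun i q => next i q) i
  exact ⟨fun i => (p i).1.1, fun i => (p i).1.2, rfl, fun _ => rfl, fun i => hnext i (p i)⟩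

/-- A variational principle of Borwein-Preiss type: an approximate maximizer `z₀` of `F` is close
to a maximizer `y` of `F - ∑ 2⁻ⁱ ρ(zᵢ, ·)` among the successors of `y`. -/
theorem exists_penalized_maximum (R : X → X → Prop) (hrefl : ∀ z, R z z)
    (htrans : ∀ a b c, R a b → R b c → R a c) (F : X → ℝ) (ρ : X → X → ℝ)
    (hρ : ∀ z w, 0 ≤ ρ z w) (hρ0 : ∀ z, ρ z z = 0) (z₀ : X) {κ : ℝ} (hκ : 0 < κ)
    (hF : ∀ z, R z₀ z → F z ≤ F z₀ + κ)
    (hcomp : ∀ z : ℕ → X, z 0 = z₀ → (∀ i j, i ≤ j → R (z i) (z j)) →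
      (∀ i j, i ≤ j → ρ (z i) (z j) ≤ κ * (1 / 2) ^ i) →
      ∃ y, (∀ i, R (z i) y) ∧ (∀ i, Tendsto (fun j => ρ (z i) (z j)) atTop (𝓝 (ρ (z i) y))) ∧
        Tendsto (fun j => F (z j)) atTop (𝓝 (F y))) :
    ∃ (z : ℕ → X) (y : X), z 0 = z₀ ∧ (∀ i, R (z i) y) ∧ (∀ i, R z₀ (z i)) ∧
      (∀ i j, i ≤ j → ρ (z i) (z j) ≤ κ * (1 / 2) ^ i) ∧
      (∀ i, ρ (z i) y ≤ κ * (1 / 2) ^ i) ∧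
      ∀ w, R y w → Summable (fun i => (1 / 2 : ℝ) ^ i * ρ (z i) w) →
        F w - ∑' i, (1 / 2 : ℝ) ^ i * ρ (z i) w ≤ F y - ∑' i, (1 / 2 : ℝ) ^ i * ρ (z i) y := by
  obtain ⟨z, G, hz0, hG0, hz⟩ := exists_penalized_seq R hrefl htrans F ρ hρ z₀ hκ hF
  have hR : ∀ i j, i ≤ j → R (z i) (z j) := by
    intro i j hij
    induction j, hij using Nat.le_induction with
    | base => exact hrefl _
    | succ j _ ih => exact htrans _ _ _ ih (hz j).1
  have hGs : ∀ i w, G (i + 1) w ≤ G i w := fun i w => by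
    rw [(hz i).2.2.2 w]
    exact sub_le_self _ (mul_nonneg (by positivity) (hρ _ _))
  have hm : ∀ i, G (i + 1) (z (i + 1)) = G i (z (i + 1)) := fun i => by
    rw [(hz i).2.2.2, hρ0, mul_zero, sub_zero]
  have hms : ∀ i, G i (z i) ≤ G (i + 1) (z (i + 1)) := fun i => by
    rw [hm]; exact (hz i).2.1
  have hnest : ∀ i j, i ≤ j → ∀ w, (R (z j) w ∧ G j (z j) ≤ G j w) →
      (R (z i) w ∧ G i (z i) ≤ G i w) := by
    intro i j hij
    induction j, hij using Nat.le_induction with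
    | base => exact fun w hw => hw
    | succ j _ ih =>
      exact fun w hw => ih w ⟨htrans _ _ _ (hz j).1 hw.1,
        (hms j).trans (hw.2.trans (hGs j w))⟩
  have hclose : ∀ i w, (R (z i) w ∧ G i (z i) ≤ G i w) → ρ (z i) w ≤ κ * (1 / 2) ^ i := by
    rintro (_ | i) w hw
    · have h1 := hw.2
      rw [hG0, hG0, hz0, hρ0] at h1
      have h2 := hF w (hz0 ▸ hw.1)
      rw [hz0, pow_zero, mul_one]
      linarith
    · have h0 := hnest i (i + 1) (Nat.le_succ i) w hw
      have h1 := (hz i).2.2.1 w h0.1 h0.2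
      have h2 := hw.2
      rw [hm, (hz i).2.2.2 w] at h2
      -- The tolerance `κ 4⁻⁽ⁱ⁺¹⁾` is the penalty weight `2⁻⁽ⁱ⁺¹⁾` times the required radius. A
      -- competitor that beats the new centre after penalization must therefore lie within that
      -- radius.
      have h3 : κ * (1 / 4) ^ (i + 1) = (1 / 2 : ℝ) ^ (i + 1) * (κ * (1 / 2) ^ (i + 1)) := by
        rw [show (1 / 4 : ℝ) = 1 / 2 * (1 / 2) by norm_num, mul_pow]
        ring
      rw [h3] at h1
      have h4 : (1 / 2 : ℝ) ^ (i + 1) * ρ (z (i + 1)) w ≤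
        (1 / 2 : ℝ) ^ (i + 1) * (κ * (1 / 2) ^ (i + 1)) := by linarith
      exact le_of_mul_le_mul_left h4 (by positivity)
  have hmem : ∀ i j, i ≤ j → R (z i) (z j) ∧ G i (z i) ≤ G i (z j) := fun i j hij =>
    hnest i j hij (z j) ⟨hrefl _, le_rfl⟩
  have hGsum : ∀ i w, G i w = F w - ∑ k ∈ Finset.range (i + 1), (1 / 2 : ℝ) ^ k * ρ (z k) w := by
    intro i w
    induction i with
    | zero => simp [hG0, hz0]
    | succ i ih => rw [Finset.sum_range_succ, (hz i).2.2.2, ih]; ring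
  obtain ⟨y, hRy, hρy, hFy⟩ := hcomp z hz0 hR fun i j hij => hclose i (z j) (hmem i j hij)
  have hy : ∀ i, R (z i) y ∧ G i (z i) ≤ G i y := by
    refine fun i => ⟨hRy i, ?_⟩
    have hlim : Tendsto (fun j => G i (z j)) atTop (𝓝 (G i y)) := by
      simp only [hGsum i]
      exact hFy.sub (tendsto_finsetSum _ fun k _ => (hρy k).const_mul _)
    exact ge_of_tendsto hlim ((eventually_ge_atTop i).mono fun j hj => (hmem i j hj).2)
  have hlimG : ∀ w, Summable (fun i => (1 / 2 : ℝ) ^ i * ρ (z i) w) →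
      Tendsto (fun i => G i w) atTop (𝓝 (F w - ∑' i, (1 / 2 : ℝ) ^ i * ρ (z i) w)) := by
    intro w hw
    simp only [hGsum]
    exact (hw.hasSum.tendsto_sum_nat.comp (tendsto_add_atTop_nat 1)).const_sub _
  have hanti : ∀ w, Antitone fun i => G i w := fun w => antitone_nat_of_succ_le fun i => hGs i w
  have hmono : Monotone fun i => G i (z i) := monotone_nat_of_le_succ hms
  have hsy : Summable fun i => (1 / 2 : ℝ) ^ i * ρ (z i) y :=
    summable_half_pow_mul (A := κ) fun i => by
      rw [abs_of_nonneg (hρ _ _)]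
      exact (hclose i y (hy i)).trans
        (mul_le_of_le_one_right hκ.le (pow_le_one₀ (by norm_num) (by norm_num)))
  have hlow : ∀ i, G i (z i) ≤ F y - ∑' i, (1 / 2 : ℝ) ^ i * ρ (z i) y := fun i =>
    ge_of_tendsto (hlimG y hsy) ((eventually_ge_atTop i).mono fun j hj =>
      (hmono hj).trans (hy j).2)
  refine ⟨z, y, hz0, hRy, fun i => hz0 ▸ hR 0 i (Nat.zero_le i),
    fun i j hij => hclose i (z j) (hmem i j hij), fun i => hclose i y (hy i), fun w hw hs => ?_⟩
  -- A `w` that competes at every stage is controlled by the tolerances, which tend to 0. A `w` that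
  -- loses at some stage keeps losing, since `G i w` decreases in `i` and `G i (z i)` increases.
  by_cases H : ∀ i, G i (z i) ≤ G i w
  · have hup : ∀ i, G i w ≤ (F y - ∑' i, (1 / 2 : ℝ) ^ i * ρ (z i) y) + κ * (1 / 4) ^ (i + 1) :=
      fun i => ((hz i).2.2.1 w (htrans _ _ _ (hRy i) hw) (H i)).trans
        (by rw [← hm]; exact add_le_add_left (hlow (i + 1)) _)
    have h0 : Tendsto (fun i : ℕ => κ * (1 / 4 : ℝ) ^ (i + 1)) atTop (𝓝 0) := by
      have := ((tendsto_pow_atTop_nhds_zero_of_lt_one (r := (1 / 4 : ℝ)) (by norm_num)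
        (by norm_num)).comp (tendsto_add_atTop_nat 1)).const_mul κ
      rwa [mul_zero] at this
    have h1 := h0.const_add (F y - ∑' i, (1 / 2 : ℝ) ^ i * ρ (z i) y)
    rw [add_zero] at h1
    exact le_of_tendsto_of_tendsto' (hlimG w hs) h1 hup
  · push Not at H
    obtain ⟨i, hi⟩ := H
    exact ((hanti w).le_of_tendsto (hlimG w hs) i).trans (hi.le.trans (hlow i))

end Variational

/-! ### Freezing continuous paths -/

theorem norm_eq_supNorm (x : C0 d) : ‖x‖ = supNorm x.toD0 := by
  rw [← ZeroAtInftyContinuousMap.norm_toBCF_eq_norm, BoundedContinuousFunction.norm_eq_iSup_norm]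
  rfl

/-- Compact intervals identify the cocompact filter of the half line with `atBot`, so that the
càdlàg and continuous notions of vanishing at `-∞` match. -/
instance : CompactIccSpace Past where
  isCompact_Icc {a b} := by
    rw [Subtype.isCompact_iff]
    refine (isCompact_Icc (a := (a : ℝ)) (b := 0)).of_isClosed_subset
      (isClosed_Iic.isClosedEmbedding_subtypeVal.isClosedMap _ isClosed_Icc) ?_
    rintro _ ⟨η, hη, rfl⟩
    exact ⟨hη.1, η.2⟩

/-- The path `x_h`, for a continuous path `x`. -/
def C0.freeze (x : C0 d) (h : ℝ) : C0 d where
  toFun θ := x (shiftTime h θ)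
  continuous_toFun := x.continuous.comp (by unfold shiftTime; fun_prop)
  zero_at_infty' := by
    have : NoMinOrder Past := ⟨fun a => ⟨⟨(a : ℝ) - 1, Set.mem_Iic.mpr
      (by have : (a : ℝ) ≤ 0 := a.2; linarith)⟩, show (a : ℝ) - 1 < a by linarith⟩⟩
    rw [cocompact_eq_atBot]
    exact (DelayHJB.freeze x.toD0 h).2.2

theorem toD0_freeze (x : C0 d) (h : ℝ) : (x.freeze h).toD0 = freeze x.toD0 h := rfl

theorem norm_freeze (x : C0 d) {h : ℝ} (hh : 0 ≤ h) : ‖x.freeze h‖ = ‖x‖ := by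
  rw [norm_eq_supNorm, toD0_freeze, supNorm_freeze _ hh, norm_eq_supNorm]

theorem C0.freeze_sub (x y : C0 d) (h : ℝ) : (x - y).freeze h = x.freeze h - y.freeze h := rfl

theorem C0.freeze_freeze (x : C0 d) {g : ℝ} (h : ℝ) (hg : 0 ≤ g) :
    (x.freeze g).freeze h = x.freeze (g + h) := by
  ext1 θ
  exact congrArg x (shiftTime_shiftTime hg θ)

/-- A path in `𝒞₀` is uniformly continuous and freezing moves each time by at most `h`. Continuity
of the path is essential: a jump would not be uniformly small. -/
theorem exists_freeze_sub_le (x : C0 d) {ε : ℝ} (hε : 0 < ε) :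
    ∃ δ > 0, ∀ h, 0 ≤ h → h < δ → ‖x.freeze h - x‖ ≤ ε := by
  obtain ⟨δ, hδ, H⟩ := Metric.uniformContinuous_iff.mp
    (ZeroAtInftyContinuousMap.uniformContinuous x) ε hε
  refine ⟨δ, hδ, fun h hh hhδ => ?_⟩
  rw [norm_eq_supNorm]
  refine supNorm_le fun θ => ?_
  change ‖x (shiftTime h θ) - x θ‖ ≤ ε
  rw [← dist_eq_norm]
  refine (H ?_).le
  have hθ : (θ : ℝ) ≤ 0 := θ.2
  change |min ((θ : ℝ) + h) 0 - θ| < δ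
  rw [abs_of_nonneg (sub_nonneg.mpr (le_min (by linarith) hθ))]
  have := min_le_left ((θ : ℝ) + h) 0
  linarith

theorem tendsto_freeze {ι : Type*} {l : Filter ι} (x : C0 d) {h : ι → ℝ} (hh : ∀ k, 0 ≤ h k)
    (h0 : Tendsto h l (𝓝 0)) : Tendsto (fun k => x.freeze (h k)) l (𝓝 x) := by
  rw [Metric.tendsto_nhds]
  intro ε hε
  obtain ⟨δ, hδ, H⟩ := exists_freeze_sub_le x (half_pos hε)
  filter_upwards [h0.eventually_lt_const hδ] with k hk
  rw [dist_eq_norm]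
  linarith [H (h k) (hh k) hk]

/-- Freezing for vanishing times does not affect convergence. -/
theorem tendsto_of_tendsto_freeze {ι : Type*} {l : Filter ι} {x : C0 d} {y : ι → C0 d} {h : ι → ℝ}
    (hh : ∀ k, 0 ≤ h k) (h0 : Tendsto h l (𝓝 0))
    (hy : Tendsto (fun k => (y k).freeze (h k)) l (𝓝 x)) : Tendsto y l (𝓝 x) := by
  rw [tendsto_iff_norm_sub_tendsto_zero]
  have h1 := hy.sub (tendsto_freeze x hh h0)
  rw [sub_self] at h1
  have h2 := h1.norm
  rw [norm_zero] at h2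
  refine h2.congr fun k => ?_
  rw [← C0.freeze_sub, norm_freeze _ (hh k)]

/-! ### Perturbed test functionals -/

/-- A point of `[t, ∞) × 𝒞₀`, seen in `[t, ∞) × 𝒟₀`. -/
def liftPoint (z : ℝ × C0 d) : ℝ × D0 d := (z.1, z.2.toD0)

theorem abs_sub_le_of_penalty_le {z : ℝ × D0 d} {s r : ℝ} {x : D0 d} (hr0 : 0 ≤ r) (hr : r ≤ 1)
    (h : penalty z s x ≤ r ^ 6) : |s - z.1| ≤ r := by
  refine abs_le_of_sq_le_sq ?_ hr0
  have h1 : r ^ 6 ≤ r ^ 2 := pow_le_pow_of_le_one hr0 hr (by norm_num)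
  have h2 := gauge_nonneg (displ z s x)
  unfold penalty at h
  linarith

/-- The comparison constant 4 is absorbed by `2⁶`. -/
theorem supNorm_displ_le_of_penalty_le {z : ℝ × D0 d} {s r : ℝ} {x : D0 d} (hr0 : 0 ≤ r)
    (h : penalty z s x ≤ r ^ 6) : supNorm (displ z s x) ≤ 2 * r := by
  refine le_of_pow_le_pow_left₀ (n := 6) (by norm_num) (by positivity) ?_
  have h1 := supNorm_pow_le_gauge (displ z s x)
  have h2 := sq_nonneg (s - z.1)
  have h3 : 0 ≤ r ^ 6 := by positivity
  unfold penalty at h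
  rw [mul_pow]
  linarith

theorem exists_lt_of_pow_le_geometric {u : ℕ → ℕ → ℝ} {c : ℝ} {m : ℕ}
    (h : ∀ i j, i ≤ j → u i j ^ m ≤ c * (1 / 2) ^ i) {ε : ℝ} (hε : 0 < ε) :
    ∃ N, ∀ j, N ≤ j → u N j < ε := by
  have h0 := (tendsto_pow_atTop_nhds_zero_of_lt_one (r := (1 / 2 : ℝ)) (by norm_num)
    (by norm_num)).const_mul c
  rw [mul_zero] at h0
  obtain ⟨N, hN⟩ := (h0.eventually_lt_const (pow_pos hε m)).exists
  exact ⟨N, fun j hj => lt_of_pow_lt_pow_left₀ m hε.le ((h N j hj).trans_lt hN)⟩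

/-- A forward sequence with summable penalties converges. -/
theorem exists_limit_of_penalty_le {z : ℕ → ℝ × C0 d} {κ : ℝ}
    (hmono : ∀ i j, i ≤ j → (z i).1 ≤ (z j).1)
    (hpen : ∀ i j, i ≤ j → penalty (liftPoint (z i)) (z j).1 (z j).2.toD0 ≤ κ * (1 / 2) ^ i) :
    ∃ y : ℝ × C0 d, (∀ i, (z i).1 ≤ y.1) ∧ Tendsto (fun j => (z j).2) atTop (𝓝 y.2) ∧
      Tendsto (fun j => dInfty y.1 y.2.toD0 (z j).1 (z j).2.toD0) atTop (𝓝 0) := by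
  obtain ⟨s, hs⟩ : ∃ s, Tendsto (fun j => (z j).1) atTop (𝓝 s) := by
    refine cauchySeq_tendsto_of_complete (Metric.cauchySeq_iff'.mpr fun ε hε => ?_)
    obtain ⟨N, hN⟩ := exists_lt_of_pow_le_geometric (u := fun i j => |(z j).1 - (z i).1|) (m := 2)
      (c := κ) (fun i j hij => by
        have h1 := hpen i j hij
        have h2 := gauge_nonneg (displ (liftPoint (z i)) (z j).1 (z j).2.toD0)
        rw [sq_abs]
        unfold penalty liftPoint at *
        linarith) hε
    exact ⟨N, hN⟩
  have hle : ∀ i, (z i).1 ≤ s := fun i =>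
    ge_of_tendsto hs ((eventually_ge_atTop i).mono fun j hj => hmono i j hj)
  have hle' : ∀ i, 0 ≤ s - (z i).1 := fun i => sub_nonneg.mpr (hle i)
  have hs0 : Tendsto (fun j => s - (z j).1) atTop (𝓝 0) := by
    simpa only [sub_self] using hs.const_sub s
  -- Paths living at different times are compared after freezing all of them up to the limit time
  -- `s`. By the semigroup law and isometry of freezing, their distances are the norms of the
  -- displacements, and `𝒞₀` is complete.
  obtain ⟨x, hx⟩ : ∃ x, Tendsto (fun j => (z j).2.freeze (s - (z j).1)) atTop (𝓝 x) := by
    refine cauchySeq_tendsto_of_complete (Metric.cauchySeq_iff'.mpr fun ε hε => ?_)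
    obtain ⟨N, hN⟩ := exists_lt_of_pow_le_geometric
      (u := fun i j => supNorm (displ (liftPoint (z i)) (z j).1 (z j).2.toD0)) (m := 6)
      (c := 4 * κ) (fun i j hij => by
        have h1 := hpen i j hij
        have h2 := supNorm_pow_le_gauge (displ (liftPoint (z i)) (z j).1 (z j).2.toD0)
        have h3 := sq_nonneg ((z j).1 - (liftPoint (z i)).1)
        unfold penalty at h1
        linarith) hε
    refine ⟨N, fun j hj => ?_⟩
    refine lt_of_eq_of_lt ?_ (hN j hj)
    have e : (z N).2.freeze (s - (z N).1) =
        ((z N).2.freeze ((z j).1 - (z N).1)).freeze (s - (z j).1) := by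
      rw [C0.freeze_freeze _ _ (sub_nonneg.mpr (hmono N j hj))]
      congr 1
      ring
    rw [dist_eq_norm, e, ← C0.freeze_sub, norm_freeze _ (hle' j), norm_eq_supNorm]
    rfl
  refine ⟨(s, x), hle, tendsto_of_tendsto_freeze hle' hs0 hx, ?_⟩
  have h1 := hs0.add ((hx.const_sub x).norm)
  rw [sub_self, norm_zero, add_zero] at h1
  refine h1.congr fun j => ?_
  rw [dInfty_of_ge (hle j), norm_eq_supNorm]
  rfl

theorem ContOn.tendsto_of_dInfty {t s : ℝ} {f : ℝ → D0 d → ℝ} (hf : ContOn t f) (hs : t ≤ s)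
    {x : D0 d} {l : ℕ → ℝ} {y : ℕ → D0 d}
    (h : Tendsto (fun k => dInfty s x (l k) (y k)) atTop (𝓝 0)) (hl : ∀ᶠ k in atTop, t ≤ l k) :
    Tendsto (fun k => f (l k) (y k)) atTop (𝓝 (f s x)) :=
  (contOn_iff_tendsto.mp hf s hs x).comp (tendsto_pathNhds h hl)

/-- The variational principle for the functional `w(y) - φ(s, y)` of continuous paths. -/
theorem exists_pathwise_maximum {t : ℝ} {x : C0 d} {w : C0 d → ℝ} {φ : ℝ → D0 d → ℝ}
    (hφ : ContOn t φ) (hw : Continuous w) {κ : ℝ} (hκ : 0 < κ)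
    (hF : ∀ s, t ≤ s → ∀ y : C0 d, w y - φ s y.toD0 ≤ w x - φ t x.toD0 + κ) :
    ∃ (z : ℕ → ℝ × C0 d) (s : ℝ) (y : C0 d), z 0 = (t, x) ∧ (∀ i, (z i).1 ≤ s) ∧
      (∀ i, t ≤ (z i).1) ∧
      (∀ i j, i ≤ j → penalty (liftPoint (z i)) (z j).1 (z j).2.toD0 ≤ κ * (1 / 2) ^ i) ∧
      (∀ i, penalty (liftPoint (z i)) s y.toD0 ≤ κ * (1 / 2) ^ i) ∧
      ∀ l, s ≤ l → ∀ y' : C0 d,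
        Summable (fun i => (1 / 2 : ℝ) ^ i * penalty (liftPoint (z i)) l y'.toD0) →
        w y' - φ l y'.toD0 - penaltySum (fun m => liftPoint (z m)) l y'.toD0 ≤
          w y - φ s y.toD0 - penaltySum (fun m => liftPoint (z m)) s y.toD0 := by
  obtain ⟨z, y, hz0, hzy, hzt, hzz, hpen, hmax⟩ := exists_penalized_maximum
    (fun a b : ℝ × C0 d => a.1 ≤ b.1) (fun _ => le_rfl) (fun _ _ _ => le_trans)
    (fun z => w z.2 - φ z.1 z.2.toD0) (fun a b => penalty (liftPoint a) b.1 b.2.toD0)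
    (fun _ _ => penalty_nonneg _ _ _) (fun z => penalty_self (liftPoint z)) (t, x) hκ
    (fun z hz => hF z.1 hz z.2)
    (fun z hz0 hmono hpen => by
      obtain ⟨y, hzy, hy1, hy2⟩ := exists_limit_of_penalty_le hmono hpen
      have ht : ∀ j, t ≤ (z j).1 := fun j => by
        have := hmono 0 j (Nat.zero_le j)
        rwa [hz0] at this
      refine ⟨y, hzy, fun i => ?_, ?_⟩
      · exact (contOn_penalty (liftPoint (z i)) le_rfl).tendsto_of_dInfty (hzy i) hy2
          ((eventually_ge_atTop i).mono fun j hj => hmono i j hj)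
      · have h1 := (hw.tendsto y.2).comp hy1
        have h2 := hφ.tendsto_of_dInfty ((ht 0).trans (hzy 0)) hy2 (Eventually.of_forall ht)
        exact h1.sub h2)
  exact ⟨z, y.1, y.2, hz0, hzy, hzt, hzz, hpen, fun l hl y' => hmax (l, y') hl⟩

/-- A test functional at a point for `w₀` is close to a test functional at a nearby point for a
uniformly close `w`. -/
theorem exists_testAbove_near {t : ℝ} {x : C0 d} {w₀ w : C0 d → ℝ} {φ : ℝ → D0 d → ℝ}
    (hφ : φ ∈ testAbove t x w₀) (hw : Continuous w) {r : ℝ} (hr0 : 0 < r) (hr : r ≤ 1)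
    (hww : ∀ y, |w y - w₀ y| ≤ r ^ 6 / 2) :
    ∃ (s : ℝ) (y : C0 d) (ψ : ℝ → D0 d → ℝ), t ≤ s ∧ ψ ∈ testAbove s y w ∧
      dInfty t x.toD0 s y.toD0 ≤ 3 * r ∧
      |horizDeriv ψ s y.toD0 - horizDeriv φ s y.toD0| ≤ 960 * r ∧
      (∀ i, |vertDeriv i ψ s y.toD0 - vertDeriv i φ s y.toD0| ≤ 960 * r) ∧
      ∀ i j, |vertDeriv i (vertDeriv j ψ) s y.toD0 - vertDeriv i (vertDeriv j φ) s y.toD0|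
        ≤ 960 * r := by
  obtain ⟨hC, hφ0, hφs⟩ := hφ
  have hup : ∀ s, t ≤ s → ∀ y : C0 d, w₀ y - φ s y.toD0 ≤ 0 := fun s hs y =>
    hφs.1 ⟨s, hs, y, rfl⟩
  -- The uniform error `r⁶/2` enters twice, at `y` and at `x`, whence `κ = r⁶`.
  obtain ⟨z, s, y, hz0, hzy, hzt, hzz, hpen, hmax⟩ := exists_pathwise_maximum hC.cont hw
    (t := t) (x := x) (κ := r ^ 6) (by positivity) fun s hs y => by
      have h1 := hup s hs y
      have h2 := (abs_le.mp (hww y)).2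
      have h3 := (abs_le.mp (hww x)).1
      linarith
  have hts : t ≤ s := (hzt 0).trans (hzy 0)
  have hpen' : ∀ i, penalty (liftPoint (z i)) s y.toD0 ≤ r ^ 6 := fun i =>
    (hpen i).trans (mul_le_of_le_one_right (by positivity)
      (pow_le_one₀ (by norm_num) (by norm_num)))
  have hz0' : liftPoint (z 0) = (t, x.toD0) := by rw [hz0]; rfl
  have hpen0 : ∀ j, penalty (t, x.toD0) (z j).1 (z j).2.toD0 ≤ r ^ 6 := fun j => by
    have := hzz 0 j (Nat.zero_le j)
    rwa [hz0', pow_zero, mul_one] at this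
  -- Centres have times within `r ≤ 1` of `t` and paths within `2r ≤ 2` of a frozen `x`.
  set B : ℝ := |t| + 1 + (supNorm x.toD0 + 2) with hB
  have hx0 := supNorm_nonneg x.toD0
  have h1 : ∀ m, |(liftPoint (z m)).1| ≤ B := fun m => by
    have e1 : |(z m).1 - t| ≤ r := abs_sub_le_of_penalty_le hr0.le hr (hpen0 m)
    have e2 := abs_sub_abs_le_abs_sub (z m).1 t
    change |(z m).1| ≤ B
    linarith
  have h2 : ∀ m, supNorm (liftPoint (z m)).2 ≤ B := fun m => by
    have e1 := supNorm_displ_le_of_penalty_le hr0.le (hpen0 m)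
    have e2 := supNorm_add_le (displ (t, x.toD0) (z m).1 (z m).2.toD0)
      (freeze x.toD0 ((z m).1 - t))
    rw [supNorm_freeze _ (sub_nonneg.mpr (hzt m))] at e2
    have e3 : displ (t, x.toD0) (z m).1 (z m).2.toD0 + freeze x.toD0 ((z m).1 - t) =
      (z m).2.toD0 := sub_add_cancel _ _
    rw [e3] at e2
    have := abs_nonneg t
    change supNorm (z m).2.toD0 ≤ B
    linarith
  have hP : IsC12p s (penaltySum fun m => liftPoint (z m)) := isC12p_penaltySum h1 h2 hzy
  have hφs' : IsC12p s φ := hC.mono hts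
  -- Adding `c` brings the maximal value to 0 and does not affect derivatives.
  set c : ℝ := w y - φ s y.toD0 - penaltySum (fun m => liftPoint (z m)) s y.toD0 with hc
  have hφP := hφs'.add hP
  refine ⟨s, y, fun s x => φ s x + penaltySum (fun m => liftPoint (z m)) s x + c, hts,
    ⟨hφP.add (isC12p_const s c), ?_, IsGreatest.isLUB ⟨⟨s, le_rfl, y, ?_⟩, ?_⟩⟩, ?_, ?_,
    fun i => ?_, fun i j => ?_⟩
  · rw [hc]; ring
  · rw [hc]; ring
  · rintro _ ⟨l, hl, y', rfl⟩
    have := hmax l hl y' (summable_penalty h1 h2 l y'.toD0)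
    linarith
  · have e0 := hpen' 0
    rw [hz0'] at e0
    have e1 := abs_sub_le_of_penalty_le hr0.le hr e0
    have e2 := supNorm_displ_le_of_penalty_le hr0.le e0
    have e3 : dInfty t x.toD0 s y.toD0 = (s - t) + supNorm (displ (t, x.toD0) s y.toD0) := by
      rw [dInfty_of_le hts, ← supNorm_neg, neg_sub]
      rfl
    have e4 := le_abs_self (s - t)
    dsimp only at e1
    linarith
  · rw [hφP.horizDeriv_add (isC12p_const s c) le_rfl, hφs'.horizDeriv_add hP le_rfl,
      horizDeriv_const, add_zero, add_sub_cancel_left, horizDeriv_penaltySum h1 h2 hzy]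
    refine (abs_tsum_half_pow_mul_le (A := 2 * r) fun m => ?_).trans (by linarith)
    rw [abs_mul, abs_two]
    have := abs_sub_le_of_penalty_le hr0.le hr (hpen' m)
    linarith
  · rw [hφP.vertDeriv_add (isC12p_const s c) i le_rfl, hφs'.vertDeriv_add hP i le_rfl,
      vertDeriv_const, add_zero, add_sub_cancel_left, vertDeriv_penaltySum h1 h2]
    -- `192 = 6 · 2⁵`, from the gradient bound at displacement at most `2r`. Summing the weights
    -- doubles it.
    refine (abs_tsum_half_pow_mul_le (A := 192 * r) fun m => ?_).trans (by linarith)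
    have e1 := supNorm_displ_le_of_penalty_le hr0.le (hpen' m)
    have e2 := pow_le_pow_left₀ (supNorm_nonneg _) e1 5
    have e3 : r ^ 5 ≤ r := pow_le_of_le_one hr0.le hr (by norm_num)
    rw [mul_pow] at e2
    have e4 := abs_gaugeGrad_le i (displ (liftPoint (z m)) s y.toD0)
    linarith
  · rw [hφP.vertDeriv_vertDeriv_add (isC12p_const s c) i j le_rfl,
      hφs'.vertDeriv_vertDeriv_add hP i j le_rfl, vertDeriv_const, vertDeriv_const, add_zero,
      add_sub_cancel_left, vertDeriv_vertDeriv_penaltySum h1 h2]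
    -- `480 = 30 · 2⁴`, and doubling gives the common constant 960.
    refine (abs_tsum_half_pow_mul_le (A := 480 * r) fun m => ?_).trans (by linarith)
    have e1 := supNorm_displ_le_of_penalty_le hr0.le (hpen' m)
    have e2 := pow_le_pow_left₀ (supNorm_nonneg _) e1 4
    have e3 : r ^ 4 ≤ r := pow_le_of_le_one hr0.le hr (by norm_num)
    rw [mul_pow] at e2
    have e4 := abs_gaugeHess_le i j (displ (liftPoint (z m)) s y.toD0)
    linarith

/-- The path `x` frozen for vanishing times returns to `x` in norm, so `d_∞`-convergence towards a
continuous path is norm convergence. -/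
theorem tendsto_of_dInfty_tendsto {t : ℝ} {x : C0 d} {s : ℕ → ℝ} {y : ℕ → C0 d}
    (hs : ∀ k, t ≤ s k)
    (h : Tendsto (fun k => dInfty t x.toD0 (s k) (y k).toD0) atTop (𝓝 0)) :
    Tendsto y atTop (𝓝 x) := by
  have hs0 : ∀ k, 0 ≤ s k - t := fun k => sub_nonneg.mpr (hs k)
  have e : ∀ k, dInfty t x.toD0 (s k) (y k).toD0 = (s k - t) + ‖x.freeze (s k - t) - y k‖ :=
    fun k => by rw [dInfty_of_le (hs k), norm_eq_supNorm]; rfl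
  simp only [e] at h
  have h1 : Tendsto (fun k => s k - t) atTop (𝓝 0) :=
    squeeze_zero hs0 (fun k => le_add_of_nonneg_right (norm_nonneg _)) h
  have h2 : Tendsto (fun k => x.freeze (s k - t) - y k) atTop (𝓝 0) :=
    squeeze_zero_norm (fun k => le_add_of_nonneg_left (hs0 k)) h
  have h3 := (tendsto_freeze x hs0 h1).sub h2
  simpa only [sub_sub_cancel, sub_zero] using h3

theorem tendsto_of_abs_sub_le {a b e : ℕ → ℝ} {c : ℝ} (hb : Tendsto b atTop (𝓝 c))
    (he : Tendsto e atTop (𝓝 0)) (h : ∀ k, |a k - b k| ≤ e k) : Tendsto a atTop (𝓝 c) := by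
  have h1 := (squeeze_zero_norm h he).add hb
  simpa only [sub_add_cancel, zero_add] using h1

/-- Stability of test functionals under uniform convergence. -/
theorem exists_testAbove_seq {t : ℝ} {x : C0 d} {w₀ : C0 d → ℝ} {w : ℕ → C0 d → ℝ}
    {φ : ℝ → D0 d → ℝ} (hφ : φ ∈ testAbove t x w₀) (hw : ∀ k, Continuous (w k))
    (hww : ∀ k y, |w k y - w₀ y| ≤ (1 / ((k : ℝ) + 1)) ^ 6 / 2) :
    ∃ (s : ℕ → ℝ) (y : ℕ → C0 d) (ψ : ℕ → ℝ → D0 d → ℝ), (∀ k, t ≤ s k) ∧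
      (∀ k, ψ k ∈ testAbove (s k) (y k) (w k)) ∧ Tendsto y atTop (𝓝 x) ∧
      Tendsto (fun k => horizDeriv (ψ k) (s k) (y k).toD0) atTop (𝓝 (horizDeriv φ t x.toD0)) ∧
      (∀ i, Tendsto (fun k => vertGrad (ψ k) (s k) (y k).toD0 i) atTop
        (𝓝 (vertGrad φ t x.toD0 i))) ∧
      ∀ i j, Tendsto (fun k => vertHess (ψ k) (s k) (y k).toD0 i j) atTop
        (𝓝 (vertHess φ t x.toD0 i j)) := by
  have hr : Tendsto (fun k : ℕ => 1 / ((k : ℝ) + 1)) atTop (𝓝 0) :=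
    tendsto_one_div_add_atTop_nhds_zero_nat
  choose s y ψ hs hψ hd hh hv hvv using fun k : ℕ => exists_testAbove_near hφ (hw k)
    (r := 1 / ((k : ℝ) + 1)) (by positivity)
    ((div_le_one (by positivity)).mpr (by have : (0 : ℝ) ≤ k := k.cast_nonneg; linarith)) (hww k)
  have h3 := hr.const_mul 3
  have h960 := hr.const_mul 960
  rw [mul_zero] at h3 h960
  have hd0 : Tendsto (fun k => dInfty t x.toD0 (s k) (y k).toD0) atTop (𝓝 0) :=
    squeeze_zero (fun k => dInfty_nonneg _ _ _ _) hd h3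
  have hs' := Eventually.of_forall (f := atTop) hs
  exact ⟨s, y, ψ, hs, hψ, tendsto_of_dInfty_tendsto hs hd0,
    tendsto_of_abs_sub_le (hφ.1.cont_horiz.tendsto_of_dInfty le_rfl hd0 hs') h960 hh,
    fun i => tendsto_of_abs_sub_le
      ((hφ.1.cont_vert i).tendsto_of_dInfty le_rfl hd0 hs') h960 fun k => hv k i,
    fun i j => tendsto_of_abs_sub_le
      ((hφ.1.cont_vert2 i j).tendsto_of_dInfty le_rfl hd0 hs') h960
        fun k => hvv k i j⟩

theorem testBelow_eq_testAbove_neg (t : ℝ) (x : C0 d) (w : C0 d → ℝ) :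
    testBelow t x w = testAbove t x (-w) := by
  ext φ
  refine and_congr_right fun _ => and_congr ?_ ?_
  · rw [Pi.neg_apply, ← neg_add', neg_eq_zero]
  · have : {r : ℝ | ∃ s, t ≤ s ∧ ∃ y : C0 d, r = (-w) y - φ s y.toD0} =
        -{r : ℝ | ∃ s, t ≤ s ∧ ∃ y : C0 d, r = w y + φ s y.toD0} := by
      ext r
      simp only [Set.mem_neg, Set.mem_ofPred_eq, Pi.neg_apply, neg_eq_iff_eq_neg, neg_add']
    rw [this, isLUB_neg, neg_zero]

/-! ### Convergence of the Hamiltonians -/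

section Uniform

variable {U : Type*}

/-- Uniform convergence to a bounded function. -/
def UnifLim (f : ℕ → U → ℝ) (g : U → ℝ) : Prop :=
  (∃ C, ∀ u, |g u| ≤ C) ∧ TendstoUniformly f g atTop

theorem unifLim_iff {f : ℕ → U → ℝ} {g : U → ℝ} : UnifLim f g ↔ (∃ C, ∀ u, |g u| ≤ C) ∧
    ∀ ε > 0, ∀ᶠ k in atTop, ∀ u, |f k u - g u| < ε := by
  simp only [UnifLim, Metric.tendstoUniformly_iff, Real.dist_eq, abs_sub_comm]

theorem UnifLim.of_le {f : ℕ → U → ℝ} {g : U → ℝ} {C : ℝ} {e : ℕ → ℝ} (hg : ∀ u, |g u| ≤ C)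
    (he : Tendsto e atTop (𝓝 0)) (h : ∀ k u, |f k u - g u| ≤ e k) : UnifLim f g :=
  unifLim_iff.mpr ⟨⟨C, hg⟩, fun _ hε => (he.eventually_lt_const hε).mono fun k hk u =>
    (h k u).trans_lt hk⟩

theorem UnifLim.const {a : ℕ → ℝ} {b : ℝ} (h : Tendsto a atTop (𝓝 b)) :
    UnifLim (fun k (_ : U) => a k) fun _ => b :=
  .of_le (C := |b|) (e := fun k => |a k - b|) (fun _ => le_rfl)
    (tendsto_iff_norm_sub_tendsto_zero.mp h) fun _ _ => le_rfl

theorem UnifLim.add {f f' : ℕ → U → ℝ} {g g' : U → ℝ} (h : UnifLim f g) (h' : UnifLim f' g') :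
    UnifLim (fun k u => f k u + f' k u) fun u => g u + g' u := by
  obtain ⟨⟨C, hC⟩, hf⟩ := h
  obtain ⟨⟨C', hC'⟩, hf'⟩ := h'
  exact ⟨⟨C + C', fun u => (abs_add_le _ _).trans (add_le_add (hC u) (hC' u))⟩, hf.add hf'⟩

theorem UnifLim.sum {ι : Type*} (I : Finset ι) {f : ι → ℕ → U → ℝ} {g : ι → U → ℝ}
    (h : ∀ i, UnifLim (f i) (g i)) :
    UnifLim (fun k u => ∑ i ∈ I, f i k u) fun u => ∑ i ∈ I, g i u := by
  classical
  induction I using Finset.induction_on with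
  | empty => simpa using UnifLim.const (U := U) (tendsto_const_nhds (x := (0 : ℝ)))
  | insert i I hi ih =>
    simp only [Finset.sum_insert hi]
    exact (h i).add ih

theorem UnifLim.mul {f f' : ℕ → U → ℝ} {g g' : U → ℝ} (h : UnifLim f g) (h' : UnifLim f' g') :
    UnifLim (fun k u => f k u * f' k u) fun u => g u * g' u := by
  rw [unifLim_iff] at h h'
  obtain ⟨⟨C, hC⟩, hf⟩ := h
  obtain ⟨⟨C', hC'⟩, hf'⟩ := h'
  refine unifLim_iff.mpr ⟨⟨|C| * |C'|, fun u => ?_⟩, fun ε hε => ?_⟩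
  · rw [abs_mul]
    exact mul_le_mul ((hC u).trans (le_abs_self C)) ((hC' u).trans (le_abs_self C'))
      (abs_nonneg _) (abs_nonneg _)
  · have hD : 0 < |C| + 1 + (|C'| + 1) := by positivity
    filter_upwards [hf _ (div_pos hε hD), hf' _ (div_pos hε hD), hf 1 one_pos] with k h1 h2 h3 u
    have e1 := h1 u
    have e2 := h2 u
    have e3 : |f k u| ≤ |C| + 1 := by
      have := abs_sub_abs_le_abs_sub (f k u) (g u)
      have := hC u
      have := le_abs_self C
      have := h3 u
      linarith
    have e4 : |g' u| ≤ |C'| + 1 := by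
      have := hC' u
      have := le_abs_self C'
      linarith
    calc |f k u * f' k u - g u * g' u|
        = |f k u * (f' k u - g' u) + (f k u - g u) * g' u| := by congr 1; ring
      _ ≤ |f k u| * |f' k u - g' u| + |f k u - g u| * |g' u| := by
          rw [← abs_mul, ← abs_mul]; exact abs_add_le _ _
      _ ≤ (|C| + 1) * |f' k u - g' u| + |f k u - g u| * (|C'| + 1) := by gcongr
      _ < (|C| + 1) * (ε / (|C| + 1 + (|C'| + 1))) +
          (ε / (|C| + 1 + (|C'| + 1))) * (|C'| + 1) := by gcongr
      _ = ε := by field_simp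

/-- An infimum is 1-Lipschitz for the sup distance. Boundedness of the limit ensures that the infima
are genuine and not default values. -/
theorem UnifLim.tendsto_iInf [Nonempty U] {f : ℕ → U → ℝ} {g : U → ℝ} (h : UnifLim f g) :
    Tendsto (fun k => ⨅ u, f k u) atTop (𝓝 (⨅ u, g u)) := by
  rw [unifLim_iff] at h
  obtain ⟨⟨C, hC⟩, hf⟩ := h
  rw [Metric.tendsto_nhds]
  intro ε hε
  filter_upwards [hf _ (half_pos hε)] with k hk
  have hg : BddBelow (Set.range g) := ⟨-C, by rintro _ ⟨u, rfl⟩; exact (abs_le.mp (hC u)).1⟩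
  have hfk : BddBelow (Set.range (f k)) := ⟨-C - ε / 2, by
    rintro _ ⟨u, rfl⟩
    have := (abs_le.mp (hC u)).1
    have := (abs_lt.mp (hk u)).1
    linarith⟩
  have h1 : (⨅ u, g u) - ε / 2 ≤ ⨅ u, f k u := le_ciInf fun u => by
    have := ciInf_le hg u
    have := (abs_lt.mp (hk u)).1
    linarith
  have h2 : (⨅ u, f k u) - ε / 2 ≤ ⨅ u, g u := le_ciInf fun u => by
    have := ciInf_le hfk u
    have := (abs_lt.mp (hk u)).2
    linarith
  rw [Real.dist_eq, abs_lt]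
  constructor <;> linarith

end Uniform

section HilbertSchmidt

attribute [local instance] Matrix.frobeniusNormedAddCommGroup

theorem abs_apply_le_hsNorm (A : Matrix (Fin d) (Fin n) ℝ) (i : Fin d) (j : Fin n) :
    |A i j| ≤ hsNorm A := by
  refine abs_le_of_sq_le_sq ?_ (norm_nonneg A)
  have h : hsNorm A ^ 2 = ∑ i, ∑ j, A i j ^ 2 := by
    have h0 : 0 ≤ ∑ i, ∑ j, A i j ^ 2 := by positivity
    rw [hsNorm, Matrix.frobenius_norm_def, ← Real.sqrt_eq_rpow]
    simp only [Real.rpow_two, Real.norm_eq_abs, sq_abs]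
    exact Real.sq_sqrt h0
  rw [h]
  exact (Finset.single_le_sum (f := fun j => A i j ^ 2) (fun _ _ => sq_nonneg _)
    (Finset.mem_univ j)).trans (Finset.single_le_sum (f := fun i => ∑ j, A i j ^ 2)
      (fun _ _ => Finset.sum_nonneg fun _ _ => sq_nonneg _) (Finset.mem_univ i))

theorem hsNorm_nonneg (A : Matrix (Fin d) (Fin n) ℝ) : 0 ≤ hsNorm A := norm_nonneg A

end HilbertSchmidt

variable {U : Type*}

theorem le_of_unifDist_le {G' G : Generators d n U} {v' v : C0 d → ℝ} {δ : ℝ} (hδ : 0 ≤ δ)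
    (h : unifDist G' G v' v ≤ ENNReal.ofReal δ) (x : C0 d) (u : U) :
    ‖G'.b (x, u) - G.b (x, u)‖ ≤ δ ∧ hsNorm (G'.σ (x, u) - G.σ (x, u)) ≤ δ ∧
      |G'.q (x, u) - G.q (x, u)| ≤ δ ∧ |v' x - v x| ≤ δ := by
  have h1 := (ENNReal.ofReal_le_ofReal_iff hδ).mp
    ((le_iSup (fun p : C0 d × U => ENNReal.ofReal (‖G'.b p - G.b p‖ + hsNorm (G'.σ p - G.σ p) +
      |G'.q p - G.q p| + |v' p.1 - v p.1|)) (x, u)).trans h)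
  have e1 := norm_nonneg (G'.b (x, u) - G.b (x, u))
  have e2 := hsNorm_nonneg (G'.σ (x, u) - G.σ (x, u))
  have e3 := abs_nonneg (G'.q (x, u) - G.q (x, u))
  have e4 := abs_nonneg (v' x - v x)
  dsimp only at h1
  refine ⟨?_, ?_, ?_, ?_⟩ <;> linarith

/-- The Hamiltonian in coordinates. -/
theorem hamiltonian_eq (G : Generators d n U) (x : C0 d) (p : E d)
    (l : Matrix (Fin d) (Fin d) ℝ) : G.hamiltonian x p l = ⨅ u : U,
      ((∑ i, p i * G.b (x, u) i) +
        (1 / 2) * (∑ i, ∑ j, l i j * ∑ k, G.σ (x, u) j k * G.σ (x, u) i k) + G.q (x, u)) := by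
  unfold Generators.hamiltonian
  congr 1
  funext u
  congr 2
  rw [PiLp.inner_apply]
  exact Finset.sum_congr rfl fun i _ => mul_comm _ _

/-- Coefficients at `y k` are compared with those of `G` at `y k` by the uniform error, then with
those of `G` at `x` by the Lipschitz bound of `G`. Both estimates are uniform in the control, and
linear growth bounds the limit at the fixed path `x`. -/
theorem tendsto_hamiltonian [TopologicalSpace U] [Nonempty U] {G : Generators d n U}
    (hG : G.Standing) {Gk : ℕ → Generators d n U} {δ : ℕ → ℝ} (hδ : Tendsto δ atTop (𝓝 0))
    (hGk : ∀ k x u, ‖(Gk k).b (x, u) - G.b (x, u)‖ ≤ δ k ∧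
      hsNorm ((Gk k).σ (x, u) - G.σ (x, u)) ≤ δ k ∧ |(Gk k).q (x, u) - G.q (x, u)| ≤ δ k)
    {x : C0 d} {y : ℕ → C0 d} (hy : Tendsto y atTop (𝓝 x)) {p : E d} {pk : ℕ → E d}
    (hp : ∀ i, Tendsto (fun k => pk k i) atTop (𝓝 (p i))) {l : Matrix (Fin d) (Fin d) ℝ}
    {lk : ℕ → Matrix (Fin d) (Fin d) ℝ} (hl : ∀ i j, Tendsto (fun k => lk k i j) atTop (𝓝 (l i j))) :
    Tendsto (fun k => (Gk k).hamiltonian (y k) (pk k) (lk k)) atTop (𝓝 (G.hamiltonian x p l)) := by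
  obtain ⟨-, -, -, L, hL, hgrow, hlip⟩ := hG
  set K : ℝ := L * (1 + ‖x‖) with hK
  have hK0 : 0 ≤ K := by positivity
  have hKsq : L ^ 2 * (1 + ‖x‖ ^ 2) ≤ K ^ 2 := by
    rw [hK, mul_pow]
    gcongr
    nlinarith [norm_nonneg x]
  have he : Tendsto (fun k => δ k + L * ‖y k - x‖) atTop (𝓝 0) := by
    have := hδ.add ((tendsto_iff_norm_sub_tendsto_zero.mp hy).const_mul L)
    rwa [mul_zero, add_zero] at this
  have hb : ∀ i, UnifLim (fun k u => (Gk k).b (y k, u) i) fun u => G.b (x, u) i := fun i => by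
    refine .of_le (C := K) (fun u => ?_) he fun k u => ?_
    · exact (PiLp.norm_apply_le _ i).trans
        (le_of_sq_le_sq ((hgrow x u).1.trans hKsq) hK0)
    · refine (PiLp.norm_apply_le ((Gk k).b (y k, u) - G.b (x, u)) i).trans ?_
      rw [← sub_add_sub_cancel _ (G.b (y k, u))]
      exact (norm_add_le _ _).trans (add_le_add (hGk k (y k) u).1 (hlip (y k) x u).1)
  have hσ : ∀ i j, UnifLim (fun k u => (Gk k).σ (y k, u) i j) fun u => G.σ (x, u) i j :=
    fun i j => by
    refine .of_le (C := K) (fun u => ?_) he fun k u => ?_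
    · exact (abs_apply_le_hsNorm _ i j).trans
        (le_of_sq_le_sq ((hgrow x u).2.1.trans hKsq) hK0)
    · rw [← sub_add_sub_cancel _ (G.σ (y k, u) i j)]
      exact (abs_add_le _ _).trans (add_le_add
        ((abs_apply_le_hsNorm ((Gk k).σ (y k, u) - G.σ (y k, u)) i j).trans
          (hGk k (y k) u).2.1)
        ((abs_apply_le_hsNorm (G.σ (y k, u) - G.σ (x, u)) i j).trans (hlip (y k) x u).2.1))
  have hq : UnifLim (fun k u => (Gk k).q (y k, u)) fun u => G.q (x, u) := by
    refine .of_le (C := K) (fun u => ?_) he fun k u => ?_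
    · exact le_of_sq_le_sq ((hgrow x u).2.2.trans hKsq) hK0
    · rw [← sub_add_sub_cancel _ (G.q (y k, u))]
      exact (abs_add_le _ _).trans (add_le_add (hGk k (y k) u).2.2 (hlip (y k) x u).2.2)
  simp only [hamiltonian_eq]
  exact (((UnifLim.sum _ fun i => (UnifLim.const (hp i)).mul (hb i)).add
    ((UnifLim.const tendsto_const_nhds).mul (UnifLim.sum _ fun i => UnifLim.sum _ fun j =>
      (UnifLim.const (hl i j)).mul (UnifLim.sum _ fun k => (hσ j k).mul (hσ i k))))).add
    hq).tendsto_iInf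

/-! ### Extraction of a sequence of parameters and passage to the limit. -/

theorem exists_seq_of_unifDist_tendsto {G : Generators d n U} {v : C0 d → ℝ}
    {Gε : ℝ → Generators d n U} {vε : ℝ → C0 d → ℝ}
    (hconv : Tendsto (fun ε : ℝ => unifDist (Gε ε) G (vε ε) v) (𝓝[>] 0) (𝓝 0)) :
    ∃ ε : ℕ → ℝ, (∀ k, 0 < ε k) ∧ ∀ k x u,
      ‖(Gε (ε k)).b (x, u) - G.b (x, u)‖ ≤ (1 / ((k : ℝ) + 1)) ^ 6 / 2 ∧
      hsNorm ((Gε (ε k)).σ (x, u) - G.σ (x, u)) ≤ (1 / ((k : ℝ) + 1)) ^ 6 / 2 ∧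
      |(Gε (ε k)).q (x, u) - G.q (x, u)| ≤ (1 / ((k : ℝ) + 1)) ^ 6 / 2 ∧
      |vε (ε k) x - v x| ≤ (1 / ((k : ℝ) + 1)) ^ 6 / 2 := by
  -- The tolerance is `r⁶/2` with `r = 1 / (k + 1)`, as needed for the perturbed test functionals.
  have h : ∀ k : ℕ, ∃ ε : ℝ, 0 < ε ∧
      unifDist (Gε ε) G (vε ε) v ≤ ENNReal.ofReal ((1 / ((k : ℝ) + 1)) ^ 6 / 2) := fun k => by
    have h0 : 0 < ENNReal.ofReal ((1 / ((k : ℝ) + 1)) ^ 6 / 2) :=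
      ENNReal.ofReal_pos.mpr (by positivity)
    obtain ⟨ε, h1, h2⟩ := ((hconv.eventually_lt_const h0).and self_mem_nhdsWithin).exists
    exact ⟨ε, h2, h1.le⟩
  choose ε hε hle using h
  exact ⟨ε, hε, fun k => le_of_unifDist_le (by positivity) (hle k)⟩

theorem tendsto_one_div_pow_six :
    Tendsto (fun k : ℕ => (1 / ((k : ℝ) + 1)) ^ 6 / 2) atTop (𝓝 0) := by
  have h := ((tendsto_one_div_add_atTop_nhds_zero_nat (𝕜 := ℝ)).pow 6).div_const 2
  rwa [zero_pow (by norm_num), zero_div] at h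

end DelayHJB
end

open DelayHJB in
theorem theorem5p7 {d n : ℕ} {U : Type*} [TopologicalSpace U] [PolishSpace U] [Nonempty U]
    (lam : ℝ) (G : Generators d n U) (hG : G.Standing)
    (v : C0 d → ℝ) (hv : Continuous v)
    (Gε : ℝ → Generators d n U) (vε : ℝ → C0 d → ℝ)
    (hGε : ∀ ε : ℝ, 0 < ε → (Gε ε).Standing)
    (hvε : ∀ ε : ℝ, 0 < ε → Continuous (vε ε))
    (hconv : Filter.Tendsto (fun ε : ℝ => unifDist (Gε ε) G (vε ε) v)
      (nhdsWithin 0 (Set.Ioi 0)) (nhds 0)) :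
    ((∀ ε : ℝ, 0 < ε → IsViscositySubsolution lam (Gε ε) (vε ε)) →
      IsViscositySubsolution lam G v) ∧
    ((∀ ε : ℝ, 0 < ε → IsViscositySupersolution lam (Gε ε) (vε ε)) →
      IsViscositySupersolution lam G v) := by
  obtain ⟨ε, hε, hclose⟩ := exists_seq_of_unifDist_tendsto hconv
  -- The distance of `vε` to `v` is measured only through pairs `(x, u)`, so some control is needed
  -- to read it off.
  have u₀ : U := Classical.arbitrary U
  have hGk := fun k x u =>
    (⟨(hclose k x u).1, (hclose k x u).2.1, (hclose k x u).2.2.1⟩ : _ ∧ _ ∧ _)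
  have hvk : ∀ y : ℕ → C0 d, ∀ x, Tendsto y atTop (𝓝 x) →
      Tendsto (fun k => vε (ε k) (y k)) atTop (𝓝 (v x)) := fun y x hy =>
    tendsto_of_abs_sub_le ((hv.tendsto x).comp hy) tendsto_one_div_pow_six
      fun k => (hclose k (y k) u₀).2.2.2
  refine ⟨fun hsub => ⟨hv, fun t ht x φ hφ => ?_⟩, fun hsup => ⟨hv, fun t ht x φ hφ => ?_⟩⟩
  · obtain ⟨s, y, ψ, hs, hψ, hy, hh, hp, hl⟩ := exists_testAbove_seq hφ
      (fun k => hvε (ε k) (hε k)) fun k y => (hclose k y u₀).2.2.2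
    have hlim := (((hvk y x hy).const_mul (-lam)).add hh).add
      (tendsto_hamiltonian hG tendsto_one_div_pow_six hGk hy hp hl)
    exact ge_of_tendsto' hlim fun k =>
      (hsub (ε k) (hε k)).2 (s k) (ht.trans (hs k)) (y k) (ψ k) (hψ k)
  · rw [testBelow_eq_testAbove_neg] at hφ
    obtain ⟨s, y, ψ, hs, hψ, hy, hh, hp, hl⟩ := exists_testAbove_seq (w := fun k => -vε (ε k)) hφ
      (fun k => (hvε (ε k) (hε k)).neg) fun k y => by
        rw [Pi.neg_apply, Pi.neg_apply, neg_sub_neg, abs_sub_comm]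
        exact (hclose k y u₀).2.2.2
    have hlim := (((hvk y x hy).const_mul (-lam)).sub hh).add
      (tendsto_hamiltonian hG tendsto_one_div_pow_six hGk hy
        (p := -vertGrad φ t x.toD0) (l := -vertHess φ t x.toD0)
        (pk := fun k => -vertGrad (ψ k) (s k) (y k).toD0) (fun i => (hp i).neg)
        (lk := fun k => -vertHess (ψ k) (s k) (y k).toD0) fun i j => (hl i j).neg)
    refine le_of_tendsto' hlim fun k =>
      (hsup (ε k) (hε k)).2 (s k) (ht.trans (hs k)) (y k) (ψ k) ?_
    rw [testBelow_eq_testAbove_neg]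
    exact hψ k
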